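/- Let $n>4$ and label the vertices of a convex $n$-gon cyclically by $\mathbb{Z}_n=\{0,\dots,n-1\}$. A triangulation of the polygon (without extra vertices) is triangle-free if none of its triangles has three internal edges (chords). A proper coloring of such a triangulation is a labeling of its $n-3$ chords by $0,\dots,n-4$, each label used once, such that the chord labeled $0$ is short (it joins $i-1$ and $i+1$ for some $i$) and, whenever a triangle has exactly two internal edges, their labels are consecutive integers. Let $\Gamma_n$ be the graph whose vertices are the properly colored triangle-free triangulations, two of them being adjacent if one is obtained from the other by a flip, i.e. by replacing a chord by the other diagonal of the quadrangle formed by its two adjacent triangles, keeping its label. Let $T_0$ be the star triangulation with chords $[0,2],[0,3],\dots,[0,n-2]$ labeled $0,\dots,n-4$ respectively, and let $T_0^R$ be the same triangulation with the chord labeled $i$ in $T_0$ relabeled $n-4-i$. Let $D(T_0)^+$ be the set of geodesics (shortest paths) in $\Gamma_n$ from $T_0$ to $T_0^R$ whose first step flips the diagonal $[0,2]$. Let $Y(n-3)$ be the set of standard Young tableaux of truncated shifted staircase shape $(n-3,n-3,n-4,\dots,2,1)$: row $r$ of the shape begins in column $r$, and its cells are filled bijectively with $1,2,\dots,N$, where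 $N$ is the number of cells, increasing along rows and down columns. Then there is a bijection $\phi: D(T_0)^+\to Y(n-3)$ such that every $u\in D(T_0)^+$ has exactly $N$ steps and, for $1\le i\le N$, the diagonal flipped (i.e. replaced) at the $i$-th step of $u$ is $[r_i-1,\,c_i+1]$, where $r_i$ and $c_i$ are the row and the column of the entry $i$ in the tableau $\phi(u)$. Moreover, the total number of geodesics in $\Gamma_n$ from $T_0$ to $T_0^R$ is twice the number of these tableaux. -/

import Mathlib

/-! Colored triangle-free triangulations of a convex `n`-gon whose vertices are labelled, in cyclic
order, by `ZMod n`; edges and chords are unordered pairs of vertices. -/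

namespace TFT

/-- An edge of the polygon. -/
def IsSide {n : ℕ} (e : Sym2 (ZMod n)) : Prop := ∃ a : ZMod n, e = s(a, a + 1)

/-- A diagonal of the polygon: a pair of distinct vertices that is not an edge of the polygon. -/
def IsDiagonal {n : ℕ} (e : Sym2 (ZMod n)) : Prop := ¬ e.IsDiag ∧ ¬ IsSide e

/-- A short chord joins `i - 1` and `i + 1` for some `i`. -/
def IsShort {n : ℕ} (e : Sym2 (ZMod n)) : Prop := ∃ i : ZMod n, e = s(i - 1, i + 1)

/-- Two chords `[a, b]` and `[c, d]` of a convex polygon cross (in the interior) iff exactly one of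
`c`, `d` lies strictly between `a` and `b`, and the other one strictly outside. -/
def Crosses {n : ℕ} (e f : Sym2 (ZMod n)) : Prop :=
  ∃ a b c d : ZMod n, e = s(a, b) ∧ f = s(c, d) ∧
    a.val < c.val ∧ c.val < b.val ∧ (d.val < a.val ∨ b.val < d.val)

/-- A triangulation (without extra vertices), given by its chords (internal edges): a maximal set
of pairwise non-crossing diagonals. -/
structure IsTriangulation {n : ℕ} (T : Set (Sym2 (ZMod n))) : Prop where
  diagonal : ∀ e ∈ T, IsDiagonal e
  noncrossing : ∀ e ∈ T, ∀ f ∈ T, ¬ Crosses e f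
  maximal : ∀ e, IsDiagonal e → (∀ f ∈ T, ¬ Crosses e f) → e ∈ T

/-- The triangle with vertices `a`, `b`, `c` is a triangle of the triangulation `T`. -/
def IsTriangle {n : ℕ} (T : Set (Sym2 (ZMod n))) (a b c : ZMod n) : Prop :=
  a ≠ b ∧ b ≠ c ∧ a ≠ c ∧
    (IsSide s(a, b) ∨ s(a, b) ∈ T) ∧ (IsSide s(b, c) ∨ s(b, c) ∈ T) ∧
    (IsSide s(a, c) ∨ s(a, c) ∈ T)

/-- No triangle has three internal edges. -/
def IsTriangleFree {n : ℕ} (T : Set (Sym2 (ZMod n))) : Prop :=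
  ∀ a b c, IsTriangle T a b c → ¬ (s(a, b) ∈ T ∧ s(b, c) ∈ T ∧ s(a, c) ∈ T)

/-- A properly colored triangle-free triangulation: `chord i` is the chord labelled `i`, where
`0 ≤ i ≤ n - 4`. -/
@[ext] structure CTFT (n : ℕ) where
  chord : Fin (n - 3) → Sym2 (ZMod n)
  injective : Function.Injective chord
  isTriangulation : IsTriangulation (Set.range chord)
  triangleFree : IsTriangleFree (Set.range chord)
  /-- One of the short chords is labelled `0`. -/
  short_zero : ∃ i, i.val = 0 ∧ IsShort (chord i)
  /-- If a triangle has exactly two internal edges, then their labels are consecutive integers. -/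
  consecutive : ∀ a b c, IsTriangle (Set.range chord) a b c →
    ∀ i j, chord i = s(a, b) → chord j = s(b, c) → s(a, c) ∉ Set.range chord →
      i.val + 1 = j.val ∨ j.val + 1 = i.val

/-- `B` is obtained from `A` by flipping the chord labelled `k`: this chord is a diagonal `[a, b]`
of the quadrangle formed by its two adjacent triangles, and is replaced by the other diagonal
`[c, d]`, which gets the same label. -/
def IsFlip {n : ℕ} (A : CTFT n) (k : Fin (n - 3)) (B : CTFT n) : Prop :=
  ∃ a b c d : ZMod n, A.chord k = s(a, b) ∧ c ≠ d ∧
    IsTriangle (Set.range A.chord) a b c ∧ IsTriangle (Set.range A.chord) a b d ∧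
    B.chord = Function.update A.chord k s(c, d)

/-- `B` is obtained from `A` by flipping the diagonal `e` of `A`. -/
def FlipsDiagonal {n : ℕ} (A B : CTFT n) (e : Sym2 (ZMod n)) : Prop :=
  ∃ k, A.chord k = e ∧ IsFlip A k B

/-- The flip graph: two distinct triangulations are adjacent if one of them is obtained from the
other by a flip. -/
def flipGraph (n : ℕ) : SimpleGraph (CTFT n) :=
  SimpleGraph.fromRel fun A B => ∃ k, IsFlip A k B

/-- The geodesics (shortest walks) from `A` to `B` in the flip graph. -/
def Geodesic {n : ℕ} (A B : CTFT n) : Type :=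
  {p : (flipGraph n).Walk A B // p.length = (flipGraph n).dist A B}

/-- The geodesics from `A` to `B` whose first step flips the diagonal `e`. -/
def GeodesicStarting {n : ℕ} (A B : CTFT n) (e : Sym2 (ZMod n)) : Type :=
  {u : Geodesic A B // FlipsDiagonal (u.1.getVert 0) (u.1.getVert 1) e}

/-- Reversal of the labelling: the chord labelled `i` gets the label `n - 4 - i`. (The hypothesis
`h`, that the chord with the last label is short, makes it immediate that the new labelling is
proper.) -/
def CTFT.reverse {n : ℕ} (T : CTFT n) (h : ∃ i, i.val + 1 = n - 3 ∧ IsShort (T.chord i)) :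
    CTFT n where
  chord := fun i => T.chord i.rev
  injective := T.injective.comp Fin.rev_injective
  isTriangulation := by
    have : Set.range (fun i : Fin (n - 3) => T.chord i.rev) = Set.range T.chord :=
      Fin.rev_surjective.range_comp T.chord
    rw [this]; exact T.isTriangulation
  triangleFree := by
    have : Set.range (fun i : Fin (n - 3) => T.chord i.rev) = Set.range T.chord :=
      Fin.rev_surjective.range_comp T.chord
    rw [this]; exact T.triangleFree
  short_zero := by
    obtain ⟨i, hi, hs⟩ := h
    refine ⟨i.rev, ?_, by simpa using hs⟩
    rw [Fin.val_rev]; omega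
  consecutive := by
    have : Set.range (fun i : Fin (n - 3) => T.chord i.rev) = Set.range T.chord :=
      Fin.rev_surjective.range_comp T.chord
    rw [this]
    intro a b c ht i j hi hj hac
    have h2 := T.consecutive a b c ht i.rev j.rev hi hj hac
    have hi := i.isLt
    have hj := j.isLt
    rw [Fin.val_rev, Fin.val_rev] at h2
    omega

theorem val_add_two {n : ℕ} (i : Fin (n - 3)) : ((i.val + 2 : ℕ) : ZMod n).val = i.val + 2 := by
  apply ZMod.val_natCast_of_lt
  have := i.isLt
  omega

theorem val_add_one' {n : ℕ} (a : ZMod n) (h : a.val + 1 < n) : (a + 1).val = a.val + 1 := by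
  have : NeZero n := ⟨by omega⟩
  have h1 : ((a.val + 1 : ℕ) : ZMod n) = a + 1 := by
    push_cast; rw [ZMod.natCast_zmod_val]
  rw [← h1, ZMod.val_natCast_of_lt h]

theorem add_one_of_val {n : ℕ} [NeZero n] {a b : ZMod n} (h : b.val = a.val + 1) :
    b = a + 1 := by
  have h1 := ZMod.natCast_zmod_val b
  rw [h] at h1
  push_cast at h1
  rw [ZMod.natCast_zmod_val] at h1
  exact h1.symm

theorem val_eq_of_add_one {n : ℕ} [NeZero n] (a : ZMod n) :
    (a + 1).val = a.val + 1 ∨ ((a + 1).val = 0 ∧ a.val + 1 = n) := by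
  rcases Nat.lt_or_ge (a.val + 1) n with h | h
  · exact Or.inl (val_add_one' a h)
  · right
    have hlt := ZMod.val_lt a
    have hn : a.val + 1 = n := by omega
    refine ⟨?_, hn⟩
    have h1 : ((a.val + 1 : ℕ) : ZMod n) = a + 1 := by
      push_cast; rw [ZMod.natCast_zmod_val]
    rw [← h1, hn, ZMod.natCast_self, ZMod.val_zero]

theorem star_isDiagonal {n : ℕ} (hn : 4 < n) (i : Fin (n - 3)) :
    IsDiagonal s((0 : ZMod n), ((i.val + 2 : ℕ) : ZMod n)) := by
  have : NeZero n := ⟨by omega⟩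
  have hv := val_add_two i
  have hi := i.isLt
  constructor
  · rw [Sym2.mk_isDiag_iff]
    intro h
    rw [← h, ZMod.val_zero] at hv
    omega
  · rintro ⟨a, ha⟩
    rw [Sym2.eq_iff] at ha
    have h3 := val_eq_of_add_one a
    rcases ha with ⟨h1, h2⟩ | ⟨h1, h2⟩
    · rw [← h2, ← h1, hv, ZMod.val_zero] at h3
      omega
    · rw [← h1, ← h2, hv, ZMod.val_zero] at h3
      omega

theorem star_isTriangulation {n : ℕ} (hn : 4 < n) :
    IsTriangulation (Set.range fun i : Fin (n - 3) =>
      s((0 : ZMod n), ((i.val + 2 : ℕ) : ZMod n))) := by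
  have : NeZero n := ⟨by omega⟩
  refine ⟨?_, ?_, ?_⟩
  · rintro e ⟨i, rfl⟩
    exact star_isDiagonal hn i
  · rintro e ⟨i, rfl⟩ f ⟨j, rfl⟩ ⟨a, b, c, d, h1, h2, h3, h4, h5⟩
    simp only [Sym2.eq_iff] at h1 h2
    rcases h1 with ⟨h1, h1'⟩ | ⟨h1, h1'⟩ <;> rcases h2 with ⟨h2, h2'⟩ | ⟨h2, h2'⟩ <;>
      subst h1 h2 <;> rw [ZMod.val_zero] at * <;> omega
  · -- every diagonal that is not in the star crosses one of its chords
    have key : ∀ a b : ZMod n, a.val < b.val → IsDiagonal s(a, b) →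
        (∀ f ∈ Set.range (fun i : Fin (n - 3) => s((0 : ZMod n), ((i.val + 2 : ℕ) : ZMod n))),
          ¬ Crosses s(a, b) f) →
        s(a, b) ∈ Set.range (fun i : Fin (n - 3) =>
          s((0 : ZMod n), ((i.val + 2 : ℕ) : ZMod n))) := by
      intro a b hab hd hc
      have hb := ZMod.val_lt b
      have hne : b.val ≠ a.val + 1 := fun h => hd.2 ⟨a, by rw [add_one_of_val h]⟩
      by_cases ha : a.val = 0
      · have ha0 : a = 0 := (ZMod.val_eq_zero a).1 ha
        subst ha0
        have hb1 : b.val + 1 ≠ n := by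
          intro h
          apply hd.2
          refine ⟨b, ?_⟩
          rcases val_eq_of_add_one b with h1 | h1
          · have := ZMod.val_lt (b + 1)
            omega
          · rw [(ZMod.val_eq_zero _).1 h1.1, Sym2.eq_swap]
        refine ⟨⟨b.val - 2, by omega⟩, ?_⟩
        have : b.val - 2 + 2 = b.val := by omega
        simp only [this, ZMod.natCast_zmod_val]
      · exfalso
        have h1 : a.val - 1 + 2 = a.val + 1 := by omega
        refine hc _ ⟨⟨a.val - 1, by omega⟩, rfl⟩
          ⟨a, b, ((a.val - 1 + 2 : ℕ) : ZMod n), 0, rfl, Sym2.eq_swap, ?_⟩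
        rw [h1, ZMod.val_natCast_of_lt (by omega), ZMod.val_zero]
        omega
    intro e
    induction e using Sym2.ind with
    | _ a b =>
      intro hd hc
      rcases lt_trichotomy a.val b.val with h | h | h
      · exact key a b h hd hc
      · exact absurd (ZMod.val_injective n h) (fun h => hd.1 (by rw [h]; rfl))
      · rw [Sym2.eq_swap] at *
        exact key b a h hd hc

/-- The canonical colored star triangulation: the chords `[0, 2], [0, 3], …, [0, n - 2]`, labelled
`0, …, n - 4` in this order. -/
def star (n : ℕ) (hn : 4 < n) : CTFT n where
  chord := fun i => s(0, ((i.val + 2 : ℕ) : ZMod n))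
  injective := by
    intro i j h
    simp only [Sym2.eq_iff] at h
    have hi := val_add_two i
    have hj := val_add_two j
    apply Fin.ext
    rcases h with ⟨_, h⟩ | ⟨h, _⟩
    · rw [h] at hi
      omega
    · rw [← h, ZMod.val_zero] at hj
      omega
  isTriangulation := star_isTriangulation hn
  triangleFree := by
    rintro a b c ⟨hab, hbc, hac, -⟩ ⟨⟨i, hi⟩, ⟨j, hj⟩, ⟨k, hk⟩⟩
    simp only [Sym2.eq_iff] at hi hj hk
    rcases hi with ⟨h1, -⟩ | ⟨h1, -⟩ <;> rcases hj with ⟨h2, -⟩ | ⟨h2, -⟩ <;>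
      rcases hk with ⟨h3, -⟩ | ⟨h3, -⟩ <;> simp_all
  short_zero := ⟨⟨0, by omega⟩, rfl, 1, by push_cast; norm_num⟩
  consecutive := by
    have : NeZero n := ⟨by omega⟩
    rintro a b c ⟨hab, hbc, hac, -, -, h⟩ i j hi hj hne
    replace h := h.resolve_right hne
    simp only [Sym2.eq_iff] at hi hj
    have vi := val_add_two i
    have vj := val_add_two j
    have li := i.isLt
    have lj := j.isLt
    obtain ⟨x, hx⟩ := h
    have h3 := val_eq_of_add_one x
    rw [Sym2.eq_iff] at hx
    rcases hi with ⟨h1, h1'⟩ | ⟨h1, h1'⟩ <;> rcases hj with ⟨h2, h2'⟩ | ⟨h2, h2'⟩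
    · exact absurd (h1.symm.trans h2) hab
    · exact absurd (h1.symm.trans h2) hac
    · rw [h1'] at vi
      rw [h2'] at vj
      rcases hx with ⟨hx, hx'⟩ | ⟨hx, hx'⟩
      · rw [← hx', ← hx, vi, vj] at h3
        omega
      · rw [← hx, ← hx', vi, vj] at h3
        omega
    · exact absurd (h1.symm.trans h2) hbc

/-- The canonical colored star triangulation with reversed labelling. -/
def starReverse (n : ℕ) (hn : 4 < n) : CTFT n :=
  (star n hn).reverse ⟨⟨n - 4, by omega⟩, by simp only; omega, -1, by
    have h : n - 4 + 2 = n - 2 := by omega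
    simp only [star, h]
    rw [Nat.cast_sub (by omega), ZMod.natCast_self, Sym2.eq_swap]
    norm_num⟩

/-- The shifted Young diagram with row lengths `L`: row `r` (rows and columns are numbered from
`1`) starts in column `r`. Cells are pairs (row, column). -/
def shiftedDiagram (L : List ℕ) : Finset (ℕ × ℕ) :=
  (Finset.Icc 1 L.length).biUnion fun r => {r} ×ˢ Finset.Ico r (r + L.getD (r - 1) 0)

/-- The row lengths `(m, m, m - 1, …, 2, 1)` of a truncated shifted staircase. -/
def truncatedStaircase (m : ℕ) : List ℕ := m :: (List.range m).map fun k => m - k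

/-- A standard tableau of shape `D`: a filling of the cells of `D` with the numbers `1, …, |D|`,
each used once, that increases along rows and down columns. -/
@[ext] structure StandardTableau (D : Finset (ℕ × ℕ)) where
  entry : D ≃ Finset.Icc 1 D.card
  row_increasing : ∀ x y : D, x.1.1 = y.1.1 → x.1.2 < y.1.2 → entry x < entry y
  col_increasing : ∀ x y : D, x.1.2 = y.1.2 → x.1.1 < y.1.1 → entry x < entry y

/-- The row in which the entry `i` is located. -/
def StandardTableau.row {D : Finset (ℕ × ℕ)} (Y : StandardTableau D) (i : Finset.Icc 1 D.card) :
    ℕ := (Y.entry.symm i).1.1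

/-- The column in which the entry `i` is located. -/
def StandardTableau.col {D : Finset (ℕ × ℕ)} (Y : StandardTableau D) (i : Finset.Icc 1 D.card) :
    ℕ := (Y.entry.symm i).1.2

end TFT

/-! Write the chord labelled `i` as an integer interval `[x i, x i + i + 2]` read modulo `n`. Proper
colouring makes these intervals nested, each one gaining one vertex at one of its two ends over the
previous one; this is `IsArcSeq`. A flip between proper colourings moves exactly one interval by one
unit (`Represents.of_isFlip`, `Represents.isFlip`). Hence a walk in the flip graph lifts to a
lattice path of integer sequences (`exists_lift`), and a lift of a triangulation is unique up to
adding a common multiple of `n` to all entries (`Represents.shift`).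

The star lifts to `0`, and the lifts of the reversed star are the translates of `topSeq` by `n * t`.
If `N` is the number of cells, then `topSeq` has sum `N`, and a translation by `n` changes the sum
by `n (n - 3) = 2 N`; so a lifted walk ends at a sequence of sum `(2 t + 1) N`. Each step changes
the sum by one. Therefore every walk has at least `N` steps, and a geodesic is either monotone
increasing (`t = 0`) or monotone decreasing (`t = -1`). `reflect` exchanges the two kinds, whence
the factor two, and starting with `[0, 2]` selects the increasing kind.

An increasing path builds the shape cell by cell: raising the entry `k` from `r - 1` to `r` adds the
cell of the diagonal `k` in row `r`, that is, in column `c = r + k`. The two inequalities of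
`IsArcSeq` are exactly the row and the column condition, so increasing paths are standard tableaux
(`StandardTableau.path`, `IsIncreasingPath.exists_standardTableau`). The chord flipped is `[r - 1, r
- 1 + k + 2] = [r - 1, c + 1]`. -/

namespace TFT

/-- The left ends of a nested sequence of integer intervals, the `i`-th one of length `i + 2`. -/
def IsArcSeq {m : ℕ} (x : Fin m → ℤ) : Prop :=
  ∀ i j : Fin m, i ≤ j → x j ≤ x i ∧ x i + i.val ≤ x j + j.val

/-- `y` is obtained from `x` by adding one to the entry `k`. -/
def IncrementsAt {m : ℕ} (k : Fin m) (x y : Fin m → ℤ) : Prop :=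
  y = Function.update x k (x k + 1)

/-- The sequence that represents the star with reversed labelling. -/
def topSeq (m : ℕ) : Fin m → ℤ := fun i => m + 1 - i.val

/-- A path of arc sequences from `0` to `topSeq m`, each one larger than the previous one by one
in one entry. -/
structure IsIncreasingPath (m N : ℕ) (X : ℕ → Fin m → ℤ) : Prop where
  zero : X 0 = 0
  last : X N = topSeq m
  arcSeq : ∀ j ≤ N, IsArcSeq (X j)
  step : ∀ j < N, ∃ k, IncrementsAt k (X j) (X (j + 1))

/-! ### The truncated shifted staircase, cut into diagonals -/

/-- The truncated shifted staircase. -/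
abbrev staircase (m : ℕ) : Finset (ℕ × ℕ) := shiftedDiagram (truncatedStaircase m)

/-- The condition `c < r + m` is the truncation: among the other cells it excludes only the corner
`(1, m + 1)`, which would be the whole diagonal `m`. -/
theorem mem_staircase {m r c : ℕ} :
    (r, c) ∈ staircase m ↔ 1 ≤ r ∧ r ≤ c ∧ c ≤ m + 1 ∧ c < r + m := by
  have hlen : (truncatedStaircase m).length = m + 1 := by simp [truncatedStaircase]
  have hget : 1 ≤ r → r ≤ m + 1 →
      (truncatedStaircase m).getD (r - 1) 0 = if r = 1 then m else m + 2 - r := by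
    intro h1 h2
    rcases r with _ | _ | s
    · omega
    · simp [truncatedStaircase]
    · have hs : s < m := by omega
      simp [truncatedStaircase, hs]
  simp only [staircase, shiftedDiagram, Finset.mem_biUnion, Finset.mem_Icc, Finset.mem_product,
    Finset.mem_singleton, Finset.mem_Ico, hlen]
  constructor
  · rintro ⟨a, ⟨h1, h2⟩, rfl, h3, h4⟩
    rw [hget h1 h2] at h4
    split_ifs at h4 <;> omega
  · rintro ⟨h1, h2, h3, h4⟩
    refine ⟨r, ⟨h1, by omega⟩, rfl, h2, ?_⟩
    rw [hget h1 (by omega)]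
    split_ifs <;> omega

theorem staircase_bounds {m : ℕ} (d : staircase m) :
    1 ≤ d.1.1 ∧ d.1.1 ≤ d.1.2 ∧ d.1.2 ≤ m + 1 ∧ d.1.2 < d.1.1 + m :=
  mem_staircase.1 d.2

/-- The number of the diagonal of a cell. -/
def diagonal {m : ℕ} (d : staircase m) : Fin m :=
  ⟨d.1.2 - d.1.1, by have := staircase_bounds d; omega⟩

/-- The cell in the row `t + 1` and on the diagonal `i`. -/
def cell {m : ℕ} (i : Fin m) (t : ℕ) (h : t < m + 1 - i.val) : staircase m :=
  ⟨(t + 1, t + 1 + i.val), mem_staircase.2 (by omega)⟩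

theorem cell_diagonal {m : ℕ} (d : staircase m) :
    ∃ h, cell (diagonal d) (d.1.1 - 1) h = d := by
  have hd := staircase_bounds d
  refine ⟨by simp only [diagonal]; omega, ?_⟩
  apply Subtype.ext
  apply Prod.ext <;> simp only [diagonal, cell] <;> omega

theorem card_staircase (m : ℕ) :
    (staircase m).card = ∑ i : Fin m, (m + 1 - i.val) := by
  have e : staircase m ≃ Σ i : Fin m, Fin (m + 1 - i.val) :=
    { toFun := fun d => ⟨diagonal d, d.1.1 - 1, (cell_diagonal d).1⟩
      invFun := fun p => cell p.1 p.2 p.2.2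
      left_inv := fun d => (cell_diagonal d).2
      right_inv := by
        rintro ⟨i, t, ht⟩
        have h1 : diagonal (cell i t ht) = i := by
          apply Fin.ext; simp [diagonal, cell]
        refine Sigma.ext h1 ((Fin.heq_ext_iff ?_).2 ?_)
        · exact congrArg (fun k : Fin m => m + 1 - k.val) h1
        · simp [cell] }
  rw [← Fintype.card_coe, Fintype.card_congr e]
  simp

theorem sum_topSeq (m : ℕ) : ∑ i, topSeq m i = (staircase m).card := by
  rw [card_staircase, Nat.cast_sum]
  refine Finset.sum_congr rfl fun i _ => ?_
  have := i.isLt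
  simp only [topSeq]
  omega

theorem two_mul_card_staircase (m : ℕ) : 2 * (staircase m).card = m * (m + 3) := by
  rw [card_staircase, Fin.sum_univ_eq_sum_range (fun i => m + 1 - i) m]
  have h : ∀ k ≤ m, 2 * ∑ i ∈ Finset.range k, ((m : ℤ) + 1 - i) = k * (2 * m + 3 - k) := by
    intro k
    induction k with
    | zero => simp
    | succ k ih =>
      intro hk
      rw [Finset.sum_range_succ, mul_add, ih (by omega)]
      push_cast
      ring
  zify
  rw [show ∑ i ∈ Finset.range m, ((m + 1 - i : ℕ) : ℤ) = ∑ i ∈ Finset.range m, ((m : ℤ) + 1 - i)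
    from Finset.sum_congr rfl fun i hi => by have := Finset.mem_range.1 hi; omega, h m le_rfl]
  ring

/-- A down-closed finite set is an initial segment, so its cardinality is a threshold. This turns
counting cells on a diagonal into comparing a row with a number. -/
theorem mem_iff_lt_card {s : Finset ℕ} (hs : ∀ t ∈ s, ∀ u < t, u ∈ s) (t : ℕ) :
    t ∈ s ↔ t < s.card := by
  constructor
  · intro h
    have h1 : Finset.range (t + 1) ⊆ s := by
      intro u hu
      rcases Nat.lt_succ_iff_lt_or_eq.1 (Finset.mem_range.1 hu) with hu | rfl
      exacts [hs t h u hu, h]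
    simpa using Finset.card_le_card h1
  · intro h
    by_contra ht
    have h1 : s ⊆ Finset.range t := by
      intro u hu
      rw [Finset.mem_range]
      by_contra hut
      rcases (not_lt.1 hut).lt_or_eq with h2 | rfl
      exacts [ht (hs u hu t h2), ht hu]
    have := Finset.card_le_card h1
    rw [Finset.card_range] at this
    omega

/-! ### From tableaux to increasing paths -/

namespace StandardTableau

variable {m : ℕ} (Y : StandardTableau (staircase m))

/-- The rows, numbered from `0`, of the cells of the diagonal `i` with entry at most `j`. -/
def rowsUpTo (j : ℕ) (i : Fin m) : Finset ℕ :=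
  (Finset.range (m + 1 - i.val)).filter fun t => ∀ h, (Y.entry (cell i t h)).1 ≤ j

/-- The number of cells with entry at most `j` on the diagonals. -/
def path (j : ℕ) (i : Fin m) : ℤ := (Y.rowsUpTo j i).card

theorem entry_le_of_le (d d' : staircase m) (h1 : d.1.1 = d'.1.1 ∨ d.1.2 = d'.1.2)
    (h2 : d.1.1 ≤ d'.1.1) (h3 : d.1.2 ≤ d'.1.2) : (Y.entry d).1 ≤ (Y.entry d').1 := by
  by_cases h : d = d'
  · rw [h]
  · rcases h1 with h1 | h1
    · exact (Y.row_increasing d d' h1 (lt_of_le_of_ne h3 fun h4 =>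
        h (Subtype.ext (Prod.ext h1 h4)))).le
    · exact (Y.col_increasing d d' h1 (lt_of_le_of_ne h2 fun h4 =>
        h (Subtype.ext (Prod.ext h4 h1)))).le

/-- Two successive cells of a diagonal are compared through a common neighbour: the cell to the
right of the first one, or, on the last diagonal, where that cell may be the truncated corner, the
cell below it. The latter lies in the shape because `2 ≤ m`. -/
theorem entry_cell_succ (hm : 2 ≤ m) (i : Fin m) (t : ℕ) (h : t < m + 1 - i.val)
    (h' : t + 1 < m + 1 - i.val) :
    (Y.entry (cell i t h)).1 ≤ (Y.entry (cell i (t + 1) h')).1 := by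
  have hi := i.isLt
  by_cases h1 : i.val + 1 < m
  · have hc : (t + 1, t + 1 + i.val + 1) ∈ staircase m := mem_staircase.2 (by omega)
    exact (Y.entry_le_of_le (cell i t h) ⟨_, hc⟩ (Or.inl rfl) le_rfl (Nat.le_succ _)).trans
      (Y.entry_le_of_le ⟨_, hc⟩ (cell i (t + 1) h') (Or.inr (by simp only [cell]; omega))
        (Nat.le_succ _) (by simp only [cell]; omega))
  · have hc : (t + 2, t + 1 + i.val) ∈ staircase m := mem_staircase.2 (by omega)
    exact (Y.entry_le_of_le (cell i t h) ⟨_, hc⟩ (Or.inr rfl) (Nat.le_succ _) le_rfl).trans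
      (Y.entry_le_of_le ⟨_, hc⟩ (cell i (t + 1) h') (Or.inl rfl) le_rfl
        (by simp only [cell]; omega))

theorem entry_cell_mono (hm : 2 ≤ m) (i : Fin m) {t u : ℕ} (htu : u ≤ t)
    (h : t < m + 1 - i.val) :
    (Y.entry (cell i u (htu.trans_lt h))).1 ≤ (Y.entry (cell i t h)).1 := by
  induction t with
  | zero => obtain rfl : u = 0 := by omega
            exact le_rfl
  | succ t ih =>
    rcases htu.lt_or_eq with h1 | rfl
    · exact (ih (by omega) (by omega)).trans (Y.entry_cell_succ hm i t _ h)
    · exact le_rfl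

theorem entry_cell_le_iff (hm : 2 ≤ m) (i : Fin m) (t : ℕ) (h : t < m + 1 - i.val) (j : ℕ) :
    (Y.entry (cell i t h)).1 ≤ j ↔ (t : ℤ) < Y.path j i := by
  rw [path, Nat.cast_lt, ← mem_iff_lt_card]
  · simp only [rowsUpTo, Finset.mem_filter, Finset.mem_range]
    exact ⟨fun h1 => ⟨h, fun _ => h1⟩, fun h1 => h1.2 h⟩
  · intro t ht u hu
    simp only [rowsUpTo, Finset.mem_filter, Finset.mem_range] at ht ⊢
    exact ⟨hu.trans ht.1, fun _ => (Y.entry_cell_mono hm i hu.le ht.1).trans (ht.2 _)⟩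

theorem entry_le_iff (hm : 2 ≤ m) (d : staircase m) (j : ℕ) :
    (Y.entry d).1 ≤ j ↔ (d.1.1 : ℤ) ≤ Y.path j (diagonal d) := by
  obtain ⟨h, hd⟩ := cell_diagonal d
  have h1 := staircase_bounds d
  have h2 := Y.entry_cell_le_iff hm (diagonal d) (d.1.1 - 1) h j
  rw [hd] at h2
  rw [h2]
  omega

theorem path_nonneg (j : ℕ) (i : Fin m) : 0 ≤ Y.path j i := Int.natCast_nonneg _

theorem path_le (j : ℕ) (i : Fin m) : Y.path j i ≤ topSeq m i := by
  have h1 : (Y.rowsUpTo j i).card ≤ _ := Finset.card_filter_le _ _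
  rw [Finset.card_range] at h1
  have := i.isLt
  simp only [path, topSeq]
  omega

theorem path_zero : Y.path 0 = 0 := by
  funext i
  simp only [path, Pi.zero_apply, Nat.cast_eq_zero, Finset.card_eq_zero, rowsUpTo]
  rw [Finset.filter_eq_empty_iff]
  intro t ht h
  have h1 := h (Finset.mem_range.1 ht)
  have h2 := (Finset.mem_Icc.1 (Y.entry (cell i t (Finset.mem_range.1 ht))).2).1
  omega

theorem path_last : Y.path (staircase m).card = topSeq m := by
  funext i
  have h : Y.rowsUpTo (staircase m).card i = Finset.range (m + 1 - i.val) := by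
    rw [rowsUpTo, Finset.filter_eq_self]
    intro t _ h
    exact (Finset.mem_Icc.1 (Y.entry (cell i t h)).2).2
  have := i.isLt
  simp only [path, h, Finset.card_range, topSeq]
  omega

/-- The first inequality compares cells of two diagonals in a common row, the second one cells in a
common column. In both cases a violation puts a cell with entry at most `j` to the right of, or
below, the first uncounted cell of the other diagonal. -/
theorem path_isArcSeq (hm : 2 ≤ m) (j : ℕ) : IsArcSeq (Y.path j) := by
  intro i i' hii
  have hle : i.val ≤ i'.val := hii
  have hi := i'.isLt
  have p1 := Y.path_nonneg j i
  have p2 := Y.path_nonneg j i'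
  have q1 := Y.path_le j i
  have q2 := Y.path_le j i'
  simp only [topSeq] at q1 q2
  constructor
  · by_contra hlt
    obtain ⟨t, ht⟩ : ∃ t : ℕ, Y.path j i = t := ⟨_, (Int.toNat_of_nonneg p1).symm⟩
    have h1 := (Y.entry_cell_le_iff hm i' t (by omega) j).2 (by omega)
    have h2 := (Y.entry_cell_le_iff hm i t (by omega) j).1
      ((Y.entry_le_of_le (cell i t (by omega)) (cell i' t (by omega)) (Or.inl rfl) le_rfl
        (by simp only [cell]; omega)).trans h1)
    omega
  · by_contra hlt
    obtain ⟨t, ht⟩ : ∃ t : ℕ, Y.path j i' = t := ⟨_, (Int.toNat_of_nonneg p2).symm⟩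
    have h1 := (Y.entry_cell_le_iff hm i (t + (i'.val - i.val)) (by omega) j).2 (by omega)
    have h2 := (Y.entry_cell_le_iff hm i' t (by omega) j).1
      ((Y.entry_le_of_le _ (cell i (t + (i'.val - i.val)) (by omega))
        (Or.inr (by simp only [cell]; omega)) (by simp only [cell]; omega)
        (by simp only [cell]; omega)).trans h1)
    omega

/-- The second conjunct locates the interval before it moves; it is what identifies the flipped
chord. -/
theorem path_succ (hm : 2 ≤ m) (j : ℕ) (d : staircase m) (hd : (Y.entry d).1 = j + 1) :
    IncrementsAt (diagonal d) (Y.path j) (Y.path (j + 1)) ∧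
      Y.path j (diagonal d) = d.1.1 - 1 := by
  have h1 := staircase_bounds d
  obtain ⟨hlt, hcell⟩ := cell_diagonal d
  have key : ∀ i : Fin m, i ≠ diagonal d → Y.rowsUpTo (j + 1) i = Y.rowsUpTo j i := by
    intro i hi
    refine Finset.filter_congr fun t ht => ?_
    refine forall_congr' fun h => ⟨fun h2 => ?_, fun h2 => by omega⟩
    rcases h2.lt_or_eq with h3 | h3
    · omega
    · exfalso
      have h4 : cell i t h = d := Y.entry.injective (Subtype.ext (h3.trans hd.symm))
      apply hi
      rw [← h4]
      apply Fin.ext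
      simp [diagonal, cell]
  have e1 := (Y.entry_le_iff hm d j).not.1 (by omega)
  have e2 := (Y.entry_le_iff hm d (j + 1)).1 (by omega)
  -- Otherwise the preceding cell of the diagonal has an entry above `j` and at most `j + 1`, the
  -- same as that of `d`. The bound `e4` follows in the same way from the next cell.
  have e3 : (d.1.1 : ℤ) - 1 ≤ Y.path j (diagonal d) := by
    by_contra hc
    have hd1 : d.1.1 - 2 < m + 1 - (diagonal d).val := by omega
    have p1 := Y.path_nonneg j (diagonal d)
    have h5 := (Y.entry_cell_le_iff hm (diagonal d) (d.1.1 - 2) hd1 j).not.2 (by omega)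
    have h6 := Y.entry_cell_mono hm (diagonal d)
      (show d.1.1 - 2 ≤ d.1.1 - 1 by omega) hlt
    rw [hcell, hd] at h6
    have h7 : cell (diagonal d) (d.1.1 - 2) hd1 = cell (diagonal d) (d.1.1 - 1) hlt :=
      Y.entry.injective (Subtype.ext (by rw [hcell, hd]; exact le_antisymm h6 (by omega)))
    have h8 := congrArg (fun x => x.1.1) h7
    simp only [cell] at h8
    omega
  have e4 : Y.path (j + 1) (diagonal d) ≤ d.1.1 := by
    by_contra hc
    have q := Y.path_le (j + 1) (diagonal d)
    simp only [topSeq] at q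
    have hd1 : d.1.1 < m + 1 - (diagonal d).val := by omega
    have h5 := (Y.entry_cell_le_iff hm (diagonal d) d.1.1 hd1 (j + 1)).2 (by omega)
    have h6 := Y.entry_cell_mono hm (diagonal d) (Nat.sub_le d.1.1 1) hd1
    rw [hcell, hd] at h6
    have h7 : cell (diagonal d) d.1.1 hd1 = cell (diagonal d) (d.1.1 - 1) hlt :=
      Y.entry.injective (Subtype.ext (by rw [hcell, hd]; exact le_antisymm h5 h6))
    have h8 := congrArg (fun x => x.1.1) h7
    simp only [cell] at h8
    omega
  refine ⟨?_, by omega⟩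
  funext i
  by_cases hi : i = diagonal d
  · subst hi
    rw [Function.update_self]
    omega
  · rw [Function.update_of_ne hi, path, path, key i hi]

theorem isIncreasingPath_path (hm : 2 ≤ m) :
    IsIncreasingPath m (staircase m).card Y.path where
  zero := Y.path_zero
  last := Y.path_last
  arcSeq := fun j _ => Y.path_isArcSeq hm j
  step := fun j hj => by
    refine ⟨_, (Y.path_succ hm j (Y.entry.symm ⟨j + 1, Finset.mem_Icc.2 (by omega)⟩) ?_).1⟩
    rw [Equiv.apply_symm_apply]

theorem eq_of_path_eq (hm : 2 ≤ m) (Y' : StandardTableau (staircase m))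
    (h : ∀ j ≤ (staircase m).card, Y.path j = Y'.path j) : Y = Y' := by
  apply StandardTableau.ext
  apply Equiv.ext
  intro d
  apply Subtype.ext
  apply le_antisymm
  · rw [Y.entry_le_iff hm, h _ (Finset.mem_Icc.1 (Y'.entry d).2).2, ← Y'.entry_le_iff hm]
  · rw [Y'.entry_le_iff hm, ← h _ (Finset.mem_Icc.1 (Y.entry d).2).2, ← Y.entry_le_iff hm]

end StandardTableau

/-- The tableau filled row by row. -/
theorem nonempty_standardTableau (D : Finset (ℕ × ℕ)) : Nonempty (StandardTableau D) := by
  let E : Finset (ℕ ×ₗ ℕ) := D.map toLex.toEmbedding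
  have hE : E.card = D.card := Finset.card_map _
  let e1 : D ≃ E := toLex.subtypeEquiv fun a => by simp [E]
  let e2 : Fin D.card ≃o E := E.orderIsoOfFin hE
  let e3 : Fin D.card ≃ Finset.Icc 1 D.card :=
    { toFun := fun i => ⟨i.val + 1, Finset.mem_Icc.2 (by omega)⟩
      invFun := fun i => ⟨i.1 - 1, by have := Finset.mem_Icc.1 i.2; omega⟩
      left_inv := fun i => by simp
      right_inv := fun i => by
        have := Finset.mem_Icc.1 i.2
        apply Subtype.ext
        simp only
        omega }
  have hlt : ∀ x y : D, toLex x.1 < toLex y.1 →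
      (e1.trans (e2.symm.toEquiv.trans e3)) x < (e1.trans (e2.symm.toEquiv.trans e3)) y := by
    intro x y hxy
    have h1 : e2.symm (e1 x) < e2.symm (e1 y) := e2.symm.lt_iff_lt.2 hxy
    exact Subtype.mk_lt_mk.2 (Nat.succ_lt_succ h1)
  exact ⟨⟨e1.trans (e2.symm.toEquiv.trans e3),
    fun x y h1 h2 => hlt x y (Prod.Lex.toLex_lt_toLex.2 (Or.inr ⟨h1, h2⟩)),
    fun x y _ h2 => hlt x y (Prod.Lex.toLex_lt_toLex.2 (Or.inl h2))⟩⟩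

/-! ### From increasing paths to tableaux -/

namespace IsIncreasingPath

variable {m : ℕ} {X : ℕ → Fin m → ℤ}

theorem mono {N : ℕ} (h : IsIncreasingPath m N X) (i : Fin m) {j j' : ℕ} (hj : j ≤ j')
    (hN : j' ≤ N) : X j i ≤ X j' i := by
  induction j', hj using Nat.le_induction with
  | base => exact le_rfl
  | succ j' hj' ih =>
    obtain ⟨k, hk⟩ := h.step j' (by omega)
    refine (ih (by omega)).trans ?_
    rw [hk, Function.update_apply]
    split_ifs with hik
    · subst hik; omega
    · exact le_rfl

/-- The entry of a cell is the first time at which the path reaches its row on its diagonal. A step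
raises one coordinate by one, so different cells have different times, and counting makes the
filling bijective. -/
theorem exists_standardTableau (h : IsIncreasingPath m (staircase m).card X) (hm : 2 ≤ m) :
    ∃ Y : StandardTableau (staircase m), ∀ j ≤ (staircase m).card, Y.path j = X j := by
  classical
  have hex : ∀ d : staircase m, ∃ j, (d.1.1 : ℤ) ≤ X j (diagonal d) ∧ j ≤ (staircase m).card := by
    intro d
    refine ⟨_, ?_, le_rfl⟩
    have h1 := staircase_bounds d
    rw [h.last]
    simp only [topSeq, diagonal]
    omega
  let f : staircase m → ℕ := fun d => Nat.find (hex d)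
  have hfN : ∀ d, f d ≤ (staircase m).card := fun d => (Nat.find_spec (hex d)).2
  have hf : ∀ d, ∀ j ≤ (staircase m).card, f d ≤ j ↔ (d.1.1 : ℤ) ≤ X j (diagonal d) := by
    intro d j hj
    constructor
    · intro h1
      exact (Nat.find_spec (hex d)).1.trans (h.mono _ h1 hj)
    · intro h1
      exact Nat.find_min' (hex d) ⟨h1, hj⟩
  have hf1 : ∀ d, 1 ≤ f d := by
    intro d
    by_contra hc
    have h1 := (hf d 0 (Nat.zero_le _)).1 (by omega)
    have h2 := staircase_bounds d
    rw [h.zero, Pi.zero_apply] at h1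
    omega
  have hinj : Function.Injective f := by
    intro d d' hdd
    obtain ⟨s, hs⟩ : ∃ s, f d = s + 1 := ⟨f d - 1, by have := hf1 d; omega⟩
    have hsN := hfN d
    obtain ⟨k, hk⟩ := h.step s (by omega)
    have key : ∀ d, f d = s + 1 → diagonal d = k ∧ (d.1.1 : ℤ) = X s k + 1 := by
      intro d hd
      have h1 := (hf d s (by omega)).not.1 (by omega)
      have h2 := (hf d (s + 1) (by omega)).1 (by omega)
      rw [hk, Function.update_apply] at h2
      split_ifs at h2 with h3
      · rw [h3] at h1
        exact ⟨h3, by omega⟩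
      · exact absurd h2 h1
    obtain ⟨a1, a2⟩ := key d hs
    obtain ⟨b1, b2⟩ := key d' (by omega)
    have c1 := staircase_bounds d
    have c2 := staircase_bounds d'
    have a3 := congrArg Fin.val (a1.trans b1.symm)
    simp only [diagonal] at a3
    apply Subtype.ext
    apply Prod.ext <;> omega
  let g : staircase m → Finset.Icc 1 (staircase m).card :=
    fun d => ⟨f d, Finset.mem_Icc.2 ⟨hf1 d, hfN d⟩⟩
  have hg : Function.Bijective g := by
    rw [Fintype.bijective_iff_injective_and_card]
    exact ⟨fun d d' hdd => hinj (congrArg Subtype.val hdd), by simp⟩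
  have hle : ∀ x y : staircase m, x ≠ y →
      (∀ j ≤ (staircase m).card, (y.1.1 : ℤ) ≤ X j (diagonal y) → (x.1.1 : ℤ) ≤ X j (diagonal x)) →
      g x < g y := by
    intro x y hxy h1
    have h2 := (hf x _ (hfN y)).2 (h1 _ (hfN y) ((hf y _ (hfN y)).1 le_rfl))
    exact lt_of_le_of_ne h2 fun h3 => hxy (hg.1 h3)
  let Y : StandardTableau (staircase m) :=
    { entry := Equiv.ofBijective g hg
      row_increasing := by
        intro x y h1 h2
        refine hle x y (fun h3 => by rw [h3] at h2; omega) fun j hj h3 => ?_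
        have c1 := staircase_bounds x
        have h4 := (h.arcSeq j hj (diagonal x) (diagonal y)
          (Fin.mk_le_mk.2 (by omega))).1
        omega
      col_increasing := by
        intro x y h1 h2
        refine hle x y (fun h3 => by rw [h3] at h2; omega) fun j hj h3 => ?_
        have c1 := staircase_bounds x
        have c2 := staircase_bounds y
        have h4 := (h.arcSeq j hj (diagonal y) (diagonal x)
          (Fin.mk_le_mk.2 (by omega))).2
        simp only [diagonal] at h4 h3 ⊢
        omega }
  refine ⟨Y, fun j hj => ?_⟩
  funext i
  have hXle : X j i ≤ topSeq m i := by
    rw [← h.last]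
    exact h.mono i hj le_rfl
  have hXge : 0 ≤ X j i := by
    have := h.mono i (Nat.zero_le j) hj
    rwa [h.zero] at this
  have key : ∀ t : ℕ, t < m + 1 - i.val → ((t : ℤ) < Y.path j i ↔ (t : ℤ) < X j i) := by
    intro t ht
    rw [← Y.entry_cell_le_iff hm i t ht]
    have h1 := hf (cell i t ht) j hj
    have h2 : diagonal (cell i t ht) = i := by apply Fin.ext; simp [diagonal, cell]
    rw [h2] at h1
    refine h1.trans ?_
    simp only [cell]
    omega
  have p1 := Y.path_le j i
  have p2 := Y.path_nonneg j i
  simp only [topSeq] at hXle p1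
  have hi := i.isLt
  rcases lt_trichotomy (Y.path j i) (X j i) with h1 | h1 | h1
  · have := key (Y.path j i).toNat (by omega)
    omega
  · exact h1
  · have := key (X j i).toNat (by omega)
    omega

end IsIncreasingPath


/-! ### Sides and crossings in a rotated linear order of the vertices -/

/-- The position of the vertex `v` in the cyclic order that starts at the vertex `z`. -/
def pos {n : ℕ} (z : ℤ) (v : ZMod n) : ℤ := (v - (z : ZMod n)).val

/-- The chord `[x, x + l + 2]`. -/
def arc (n : ℕ) (l : ℕ) (x : ℤ) : Sym2 (ZMod n) :=
  s((x : ZMod n), ((x + l + 2 : ℤ) : ZMod n))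

section position

variable {n : ℕ}

theorem pos_nonneg (z : ℤ) (v : ZMod n) : 0 ≤ pos z v := Int.natCast_nonneg _

theorem crosses_iff_val (a b c d : ZMod n) :
    Crosses s(a, b) s(c, d) ↔
      (a.val < c.val ∧ c.val < b.val ∧ (d.val < a.val ∨ b.val < d.val)) ∨
      (b.val < c.val ∧ c.val < a.val ∧ (d.val < b.val ∨ a.val < d.val)) ∨
      (a.val < d.val ∧ d.val < b.val ∧ (c.val < a.val ∨ b.val < c.val)) ∨
      (b.val < d.val ∧ d.val < a.val ∧ (c.val < b.val ∨ a.val < c.val)) := by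
  constructor
  · rintro ⟨a', b', c', d', h1, h2, h⟩
    rw [Sym2.eq_iff] at h1 h2
    rcases h1 with ⟨rfl, rfl⟩ | ⟨rfl, rfl⟩ <;> rcases h2 with ⟨rfl, rfl⟩ | ⟨rfl, rfl⟩ <;> tauto
  · rintro (h | h | h | h)
    · exact ⟨a, b, c, d, rfl, rfl, h⟩
    · exact ⟨b, a, c, d, Sym2.eq_swap, rfl, h⟩
    · exact ⟨a, b, d, c, rfl, Sym2.eq_swap, h⟩
    · exact ⟨b, a, d, c, Sym2.eq_swap, Sym2.eq_swap, h⟩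

variable [NeZero n] (z : ℤ)

theorem pos_lt (v : ZMod n) : pos z v < n := by
  unfold pos; exact_mod_cast ZMod.val_lt _

theorem pos_injective {v w : ZMod n} (h : pos z v = pos z w) : v = w := by
  have h1 : (v - (z : ZMod n)) = w - (z : ZMod n) := ZMod.val_injective n (by
    unfold pos at h; exact_mod_cast h)
  exact sub_left_injective h1

theorem pos_intCast {y : ℤ} (h0 : z ≤ y) (hy : y < z + n) : pos z (y : ZMod n) = y - z := by
  unfold pos
  rw [← Int.cast_sub, ZMod.val_intCast, Int.emod_eq_of_lt (by omega) (by omega)]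

theorem pos_val (v : ZMod n) :
    (pos z v = v.val - (z : ZMod n).val ∨ pos z v = v.val - (z : ZMod n).val + n) := by
  unfold pos
  have h1 := ZMod.val_lt (v - (z : ZMod n))
  have h2 := ZMod.val_lt (z : ZMod n)
  have h3 : v = (v - (z : ZMod n)) + (z : ZMod n) := by ring
  rcases lt_or_ge ((v - (z : ZMod n)).val + (z : ZMod n).val) n with h | h
  · have := ZMod.val_add_of_lt h
    rw [← h3] at this
    omega
  · have := ZMod.val_add_of_le h
    rw [← h3] at this
    omega

theorem isSide_iff (a b : ZMod n) :
    IsSide s(a, b) ↔ pos z b = pos z a + 1 ∨ pos z a = pos z b + 1 ∨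
      (pos z a = 0 ∧ pos z b = n - 1) ∨ (pos z b = 0 ∧ pos z a = n - 1) := by
  have hadd : ∀ x : ZMod n, pos z (x + 1) = pos z x + 1 ∨
      (pos z (x + 1) = 0 ∧ pos z x = n - 1) := by
    intro x
    have h := val_eq_of_add_one (x - (z : ZMod n))
    unfold pos
    rw [add_sub_right_comm]
    omega
  constructor
  · rintro ⟨x, hx⟩
    rw [Sym2.eq_iff] at hx
    have := hadd x
    rcases hx with ⟨rfl, rfl⟩ | ⟨rfl, rfl⟩ <;> omega
  · have key : ∀ a b : ZMod n, (pos z b = pos z a + 1 ∨ (pos z b = 0 ∧ pos z a = n - 1)) →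
        b = a + 1 := by
      intro a b h
      apply pos_injective z
      have := hadd a
      have := pos_lt z b
      have := pos_lt z (a + 1)
      have := pos_nonneg z (a + 1)
      have := pos_nonneg z a
      omega
    intro h
    by_cases h1 : pos z b = pos z a + 1 ∨ (pos z b = 0 ∧ pos z a = n - 1)
    · exact ⟨a, by rw [key a b h1]⟩
    · exact ⟨b, by rw [key b a (by omega), Sym2.eq_swap]⟩

/-- Crossing chords `[a, b]` and `[c, d]`, in terms of the positions of their ends. -/
def CrossesInt (a b c d : ℤ) : Prop :=
  (a < c ∧ c < b ∧ (d < a ∨ b < d)) ∨ (b < c ∧ c < a ∧ (d < b ∨ a < d)) ∨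
    (a < d ∧ d < b ∧ (c < a ∨ b < c)) ∨ (b < d ∧ d < a ∧ (c < b ∨ a < c))

theorem CrossesInt.swap_left {a b c d : ℤ} (h : CrossesInt a b c d) : CrossesInt b a c d := by
  rcases h with h | h | h | h
  exacts [Or.inr (Or.inl h), Or.inl h, Or.inr (Or.inr (Or.inr h)), Or.inr (Or.inr (Or.inl h))]

theorem CrossesInt.swap_right {a b c d : ℤ} (h : CrossesInt a b c d) : CrossesInt a b d c := by
  rcases h with h | h | h | h
  exacts [Or.inr (Or.inr (Or.inl h)), Or.inr (Or.inr (Or.inr h)), Or.inl h, Or.inr (Or.inl h)]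

theorem crossesInt_rotate_of_lt {a b c d a' b' c' d' z N : ℤ}
    (h : a < c ∧ c < b ∧ (d < a ∨ b < d))
    (ha : a' = a - z ∨ a' = a - z + N) (hb : b' = b - z ∨ b' = b - z + N)
    (hc : c' = c - z ∨ c' = c - z + N) (hd : d' = d - z ∨ d' = d - z + N)
    (a0 : 0 ≤ a ∧ a < N) (b0 : 0 ≤ b ∧ b < N) (c0 : 0 ≤ c ∧ c < N) (d0 : 0 ≤ d ∧ d < N)
    (a1 : 0 ≤ a' ∧ a' < N) (b1 : 0 ≤ b' ∧ b' < N) (c1 : 0 ≤ c' ∧ c' < N)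
    (d1 : 0 ≤ d' ∧ d' < N) : CrossesInt a' b' c' d' := by
  obtain ⟨h1, h2, h3⟩ := h
  -- If the rotation reverses the order of the ends `a` and `b`, it is `d` instead of `c` that comes
  -- to lie between them.
  rcases lt_or_ge a' b' with h | h
  · exact Or.inl ⟨by omega, by omega, by omega⟩
  · exact Or.inr (Or.inr (Or.inr ⟨by omega, by omega, by omega⟩))

theorem CrossesInt.rotate {a b c d a' b' c' d' z N : ℤ} (h : CrossesInt a b c d)
    (ha : a' = a - z ∨ a' = a - z + N) (hb : b' = b - z ∨ b' = b - z + N)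
    (hc : c' = c - z ∨ c' = c - z + N) (hd : d' = d - z ∨ d' = d - z + N)
    (a0 : 0 ≤ a ∧ a < N) (b0 : 0 ≤ b ∧ b < N) (c0 : 0 ≤ c ∧ c < N) (d0 : 0 ≤ d ∧ d < N)
    (a1 : 0 ≤ a' ∧ a' < N) (b1 : 0 ≤ b' ∧ b' < N) (c1 : 0 ≤ c' ∧ c' < N)
    (d1 : 0 ≤ d' ∧ d' < N) : CrossesInt a' b' c' d' := by
  rcases h with h | h | h | h
  · exact crossesInt_rotate_of_lt h ha hb hc hd a0 b0 c0 d0 a1 b1 c1 d1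
  · exact (crossesInt_rotate_of_lt h hb ha hc hd b0 a0 c0 d0 b1 a1 c1 d1).swap_left
  · exact (crossesInt_rotate_of_lt h ha hb hd hc a0 b0 d0 c0 a1 b1 d1 c1).swap_right
  · exact (crossesInt_rotate_of_lt h hb ha hd hc b0 a0 d0 c0 b1 a1 d1
      c1).swap_left.swap_right

/-- Crossing is defined by the representatives `0, …, n - 1` but depends only on the cyclic order,
so the origin may be put at any `z`. -/
theorem crosses_iff_crossesInt (a b c d : ZMod n) :
    Crosses s(a, b) s(c, d) ↔ CrossesInt (pos z a) (pos z b) (pos z c) (pos z d) := by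
  have hv : ∀ v : ZMod n, 0 ≤ (v.val : ℤ) ∧ (v.val : ℤ) < n := fun v =>
    ⟨Int.natCast_nonneg _, by exact_mod_cast ZMod.val_lt v⟩
  have hp : ∀ v : ZMod n, 0 ≤ pos z v ∧ pos z v < n := fun v => ⟨pos_nonneg z v, pos_lt z v⟩
  have hval : Crosses s(a, b) s(c, d) ↔ CrossesInt a.val b.val c.val d.val := by
    rw [crosses_iff_val]
    simp only [CrossesInt, Nat.cast_lt]
  have hinv : ∀ v : ZMod n, (v.val : ℤ) = pos z v - (n - (z : ZMod n).val) ∨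
      (v.val : ℤ) = pos z v - (n - (z : ZMod n).val) + n := by
    intro v
    have := pos_val z v
    omega
  rw [hval]
  exact ⟨fun h => h.rotate (pos_val z a) (pos_val z b) (pos_val z c) (pos_val z d)
    (hv a) (hv b) (hv c) (hv d) (hp a) (hp b) (hp c) (hp d), fun h => h.rotate
    (hinv a) (hinv b) (hinv c) (hinv d)
    (hp a) (hp b) (hp c) (hp d) (hv a) (hv b) (hv c) (hv d)⟩

theorem crosses_iff (a b c d : ZMod n) :
    Crosses s(a, b) s(c, d) ↔
      (pos z a < pos z c ∧ pos z c < pos z b ∧ (pos z d < pos z a ∨ pos z b < pos z d)) ∨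
      (pos z b < pos z c ∧ pos z c < pos z a ∧ (pos z d < pos z b ∨ pos z a < pos z d)) ∨
      (pos z a < pos z d ∧ pos z d < pos z b ∧ (pos z c < pos z a ∨ pos z b < pos z c)) ∨
      (pos z b < pos z d ∧ pos z d < pos z a ∧ (pos z c < pos z b ∨ pos z a < pos z c)) :=
  crosses_iff_crossesInt z a b c d

theorem arc_eq_iff {l : ℕ} {x : ℤ} (h0 : z ≤ x) (h1 : x + l + 2 < z + n) (a b : ZMod n) :
    arc n l x = s(a, b) ↔ (pos z a = x - z ∧ pos z b = x - z + l + 2) ∨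
      (pos z b = x - z ∧ pos z a = x - z + l + 2) := by
  have e1 := pos_intCast (n := n) z h0 (by omega)
  have e2 := pos_intCast (n := n) (y := x + l + 2) z (by omega) h1
  rw [arc, Sym2.eq_iff]
  constructor
  · rintro (⟨rfl, rfl⟩ | ⟨rfl, rfl⟩) <;> omega
  · rintro (⟨h2, h3⟩ | ⟨h2, h3⟩)
    · exact Or.inl ⟨pos_injective z (by omega), pos_injective z (by omega)⟩
    · exact Or.inr ⟨pos_injective z (by omega), pos_injective z (by omega)⟩

end position

/-! ### Triangulations built from arc sequences -/

/-- The position of the last entry of a sequence of labelled chords. -/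
def lastIndex {n : ℕ} (hn : 4 < n) : Fin (n - 3) := ⟨n - 4, by omega⟩

namespace IsArcSeq

variable {n : ℕ} {x : Fin (n - 3) → ℤ}

/-- With the left end of the outermost interval as origin, no interval wraps around and only the
position `n - 1` lies outside all of them. All the geometry then becomes linear arithmetic. -/
theorem bounds (hn : 4 < n) (hx : IsArcSeq x) (i : Fin (n - 3)) :
    x (lastIndex hn) ≤ x i ∧ x i + i.val + 2 < x (lastIndex hn) + n - 1 := by
  have h := hx i (lastIndex hn) (Fin.mk_le_mk.2 (by have := i.isLt; omega))
  have h2 : ((lastIndex hn).val : ℤ) = n - 4 := by simp only [lastIndex]; omega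
  omega

theorem arc_eq_iff (hn : 4 < n) (hx : IsArcSeq x) (i : Fin (n - 3)) (a b : ZMod n) :
    arc n i.val (x i) = s(a, b) ↔
      (pos (x (lastIndex hn)) a = x i - x (lastIndex hn) ∧
        pos (x (lastIndex hn)) b = x i - x (lastIndex hn) + i.val + 2) ∨
      (pos (x (lastIndex hn)) b = x i - x (lastIndex hn) ∧
        pos (x (lastIndex hn)) a = x i - x (lastIndex hn) + i.val + 2) := by
  have : NeZero n := ⟨by omega⟩
  have := hx.bounds hn i
  exact TFT.arc_eq_iff _ (by omega) (by omega) a b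

theorem nested (hx : IsArcSeq x) (i j : Fin (n - 3)) :
    (i.val ≤ j.val ∧ x j ≤ x i ∧ x i + i.val ≤ x j + j.val) ∨
      (j.val < i.val ∧ x i ≤ x j ∧ x j + j.val ≤ x i + i.val) := by
  rcases lt_or_ge j i with h | h
  · exact Or.inr ⟨h, hx j i h.le⟩
  · exact Or.inl ⟨h, hx i j h⟩

/-- Take the shortest interval that contains the diagonal. The preceding interval lacks just one of
its ends, so the diagonal uses that end; not crossing the preceding interval and not being a side,
it must be the whole interval. -/
theorem maximal (hn : 4 < n) (hx : IsArcSeq x) (e : Sym2 (ZMod n)) (he : IsDiagonal e)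
    (hc : ∀ f ∈ Set.range (fun i : Fin (n - 3) => arc n i.val (x i)), ¬ Crosses e f) :
    e ∈ Set.range (fun i : Fin (n - 3) => arc n i.val (x i)) := by
  have : NeZero n := ⟨by omega⟩
  induction e using Sym2.ind with
  | _ a b =>
  set z := x (lastIndex hn) with hz
  wlog hab : pos z a ≤ pos z b generalizing a b
  · rw [Sym2.eq_swap] at he hc ⊢
    exact this b a he hc (by omega)
  have hlast : ((lastIndex hn).val : ℤ) = n - 4 := by simp only [lastIndex]; omega
  have hab' : pos z a ≠ pos z b := fun h => he.1 (by rw [pos_injective z h]; rfl)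
  have hside := he.2
  rw [isSide_iff z] at hside
  have b1 := pos_lt z b
  have a0 := pos_nonneg z a
  have hcross : ∀ i : Fin (n - 3), ¬ ((pos z a < x i - z ∧ x i - z < pos z b ∧
      pos z b < x i - z + i.val + 2) ∨ (x i - z < pos z a ∧ pos z a < x i - z + i.val + 2 ∧
      x i - z + i.val + 2 < pos z b)) := by
    intro i h
    have hb := hx.bounds hn i
    apply hc _ ⟨i, rfl⟩
    simp only [arc]
    rw [crosses_iff z, pos_intCast z (by omega) (by omega), pos_intCast z (by omega) (by omega)]
    omega
  have hmem : ∀ i : Fin (n - 3), pos z a = x i - z → pos z b = x i - z + i.val + 2 →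
      s(a, b) ∈ Set.range (fun i : Fin (n - 3) => arc n i.val (x i)) := by
    intro i h1 h2
    exact ⟨i, (hx.arc_eq_iff hn i a b).2 (Or.inl ⟨h1, h2⟩)⟩
  -- The outermost interval contains the diagonal: a diagonal from the position `n - 1` would cross
  -- it.
  have hex : ∃ j, ∃ h : j < n - 3, x ⟨j, h⟩ - z ≤ pos z a ∧ pos z b ≤ x ⟨j, h⟩ - z + j + 2 := by
    refine ⟨n - 4, by omega, ?_⟩
    have h1 := hcross (lastIndex hn)
    have h2 : x ⟨n - 4, by omega⟩ = z := rfl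
    rw [h2]
    rw [hlast, ← hz] at h1
    omega
  classical
  obtain ⟨hj, h1, h2⟩ := Nat.find_spec hex
  have hmin := fun k => Nat.find_min hex (m := k)
  generalize Nat.find hex = j at hj h1 h2 hmin
  rcases j with _ | j
  · exact hmem ⟨0, hj⟩ (by push_cast at *; omega) (by push_cast at *; omega)
  · have hj' : j < n - 3 := by omega
    have h3 := hmin j (Nat.lt_succ_self j)
    have h4 : ¬ (x ⟨j, hj'⟩ - z ≤ pos z a ∧ pos z b ≤ x ⟨j, hj'⟩ - z + j + 2) :=
      fun h => h3 ⟨hj', h⟩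
    have h5 := hx ⟨j, hj'⟩ ⟨j + 1, hj⟩ (Fin.mk_le_mk.2 (Nat.le_succ j))
    have h6 := hcross ⟨j, hj'⟩
    have h7 := hcross ⟨j + 1, hj⟩
    refine hmem ⟨j + 1, hj⟩ ?_ ?_ <;> simp only at * <;> push_cast at * <;> omega

end IsArcSeq

/-- The properly colored triangle-free triangulation with the chords `[x i, x i + i + 2]`. -/
def ofArcSeq {n : ℕ} (hn : 4 < n) (x : Fin (n - 3) → ℤ) (hx : IsArcSeq x) : CTFT n where
  chord := fun i => arc n i.val (x i)
  injective := by
    have : NeZero n := ⟨by omega⟩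
    intro i j h
    simp only at h
    have hi := hx.bounds hn i
    have hj := hx.bounds hn j
    conv_rhs at h => rw [arc]
    rw [hx.arc_eq_iff hn, pos_intCast _ (by omega) (by omega),
      pos_intCast _ (by omega) (by omega)] at h
    apply Fin.ext
    omega
  isTriangulation := by
    have : NeZero n := ⟨by omega⟩
    refine ⟨?_, ?_, hx.maximal hn⟩
    · rintro e ⟨i, rfl⟩
      have hi := hx.bounds hn i
      simp only [arc]
      constructor
      · rw [Sym2.mk_isDiag_iff]
        intro h
        have h1 := congrArg (pos (x (lastIndex hn))) h
        rw [pos_intCast _ (by omega) (by omega), pos_intCast _ (by omega) (by omega)] at h1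
        omega
      · rw [isSide_iff (x (lastIndex hn)), pos_intCast _ (by omega) (by omega),
          pos_intCast _ (by omega) (by omega)]
        omega
    · rintro e ⟨i, rfl⟩ f ⟨j, rfl⟩
      have hi := hx.bounds hn i
      have hj := hx.bounds hn j
      have hij := hx.nested i j
      simp only [arc]
      rw [crosses_iff (x (lastIndex hn)), pos_intCast _ (by omega) (by omega),
        pos_intCast _ (by omega) (by omega), pos_intCast _ (by omega) (by omega),
        pos_intCast _ (by omega) (by omega)]
      omega
  triangleFree := by
    rintro a b c - ⟨⟨i, hi⟩, ⟨j, hj⟩, ⟨k, hk⟩⟩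
    simp only at hi hj hk
    rw [hx.arc_eq_iff hn] at hi hj hk
    -- Of three intervals forming a triangle, two share only an end, which contradicts nesting.
    have hij := hx.nested i j
    have hik := hx.nested i k
    have hjk := hx.nested j k
    omega
  short_zero := ⟨⟨0, by omega⟩, rfl, (x ⟨0, by omega⟩ : ZMod n) + 1, by
    simp only [arc]
    rw [Sym2.eq_iff]
    left
    constructor <;> push_cast <;> ring⟩
  consecutive := by
    have : NeZero n := ⟨by omega⟩
    rintro a b c ⟨hab, hbc, hac, -, -, h⟩ i j hi hj hne
    replace h := h.resolve_right hne
    rw [hx.arc_eq_iff hn] at hi hj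
    rw [isSide_iff (x (lastIndex hn))] at h
    have hij := hx.nested i j
    have hi' := hx.bounds hn i
    have hj' := hx.bounds hn j
    omega


/-! ### Flips and adjacency in the flip graph -/

theorem IsTriangle.swap {n : ℕ} {T : Set (Sym2 (ZMod n))} {a b c : ZMod n}
    (h : IsTriangle T a b c) : IsTriangle T b a c := by
  obtain ⟨h1, h2, h3, h4, h5, h6⟩ := h
  exact ⟨h1.symm, h3, h2, by rwa [Sym2.eq_swap], h6, h5⟩

theorem IsFlip.symm {n : ℕ} {A B : CTFT n} {k : Fin (n - 3)} (h : IsFlip A k B) :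
    IsFlip B k A := by
  obtain ⟨a, b, c, d, hab, hcd, h1, h2, hB⟩ := h
  have hmem : ∀ e, (IsSide e ∨ e ∈ Set.range A.chord) → e ≠ s(a, b) →
      (IsSide e ∨ e ∈ Set.range B.chord) := by
    rintro e (he | ⟨i, rfl⟩) hne
    · exact Or.inl he
    · refine Or.inr ⟨i, ?_⟩
      rw [hB, Function.update_of_ne]
      rintro rfl
      exact hne hab
  have hcdB : s(c, d) ∈ Set.range B.chord := ⟨k, by rw [hB, Function.update_self]⟩
  obtain ⟨ab, bc, ac, -, sbc, sac⟩ := h1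
  obtain ⟨-, bd, ad, -, sbd, sad⟩ := h2
  refine ⟨c, d, a, b, by rw [hB, Function.update_self], ab, ⟨hcd, ad.symm, ac.symm, Or.inr hcdB,
    hmem _ (by rwa [Sym2.eq_swap]) ?_, hmem _ (by rwa [Sym2.eq_swap]) ?_⟩,
    ⟨hcd, bd.symm, bc.symm, Or.inr hcdB,
    hmem _ (by rwa [Sym2.eq_swap]) ?_, hmem _ (by rwa [Sym2.eq_swap]) ?_⟩, ?_⟩
  · rw [Ne, Sym2.eq_iff]
    rintro (⟨h, -⟩ | ⟨h, -⟩)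
    exacts [ad h.symm, bd h.symm]
  · rw [Ne, Sym2.eq_iff]
    rintro (⟨h, -⟩ | ⟨h, -⟩)
    exacts [ac h.symm, bc h.symm]
  · rw [Ne, Sym2.eq_iff]
    rintro (⟨h, -⟩ | ⟨h, -⟩)
    exacts [ad h.symm, bd h.symm]
  · rw [Ne, Sym2.eq_iff]
    rintro (⟨h, -⟩ | ⟨h, -⟩)
    exacts [ac h.symm, bc h.symm]
  · rw [hB, Function.update_idem, ← hab, Function.update_eq_self]

theorem IsFlip.ne {n : ℕ} {A B : CTFT n} {k : Fin (n - 3)} (h : IsFlip A k B) : A ≠ B := by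
  rintro rfl
  obtain ⟨a, b, c, d, hab, hcd, h1, h2, hB⟩ := h
  have := congrFun hB k
  rw [Function.update_self, hab, Sym2.eq_iff] at this
  rcases this with ⟨h, -⟩ | ⟨-, h⟩
  exacts [h1.2.2.1 h, h1.2.1 h]

theorem flipGraph_adj {n : ℕ} {A B : CTFT n} : (flipGraph n).Adj A B ↔ ∃ k, IsFlip A k B := by
  rw [flipGraph, SimpleGraph.fromRel_adj]
  constructor
  · rintro ⟨-, h | ⟨k, hk⟩⟩
    exacts [h, ⟨k, hk.symm⟩]
  · rintro ⟨k, hk⟩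
    exact ⟨hk.ne, Or.inl ⟨k, hk⟩⟩

theorem CTFT.not_internal {n : ℕ} (B : CTFT n) {a b c : ZMod n} (h1 : s(a, b) ∈ Set.range B.chord)
    (h2 : s(b, c) ∈ Set.range B.chord) (h3 : s(a, c) ∈ Set.range B.chord) : False := by
  have hd : ∀ u v, s(u, v) ∈ Set.range B.chord → u ≠ v := by
    intro u v h huv
    exact (B.isTriangulation.diagonal _ h).1 (by rw [Sym2.mk_isDiag_iff, huv])
  exact B.triangleFree a b c ⟨hd _ _ h1, hd _ _ h2, hd _ _ h3, Or.inr h1, Or.inr h2, Or.inr h3⟩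
    ⟨h1, h2, h3⟩

/-! ### Flips as unit steps of arc sequences -/

/-- The chord labelled `i` is `[x i, x i + i + 2]`. -/
def Represents {n : ℕ} (x : Fin (n - 3) → ℤ) (A : CTFT n) : Prop :=
  ∀ i, A.chord i = arc n i.val (x i)

namespace Represents

variable {n : ℕ} {x y : Fin (n - 3) → ℤ} {A B : CTFT n}

theorem unique (hA : Represents x A) (hB : Represents x B) : A = B :=
  CTFT.ext (funext fun i => (hA i).trans (hB i).symm)

/-- The chord `0` fixes the translation. Nesting keeps `x i` within distance `i` of `x 0`, which
leaves no other choice modulo `n` for the remaining entries. -/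
theorem shift (hn : 4 < n) (hx : IsArcSeq x) (hy : IsArcSeq y) (hA : Represents x A)
    (hA' : Represents y A) : ∃ t : ℤ, ∀ i, y i = x i + n * t := by
  have h : ∀ i : Fin (n - 3), ((n : ℤ) ∣ y i - x i) ∨
      ((n : ℤ) ∣ y i + i.val + 2 - x i ∧ (n : ℤ) ∣ x i + i.val + 2 - y i) := by
    intro i
    have h1 := (hA i).symm.trans (hA' i)
    rw [arc, arc, Sym2.eq_iff] at h1
    rcases h1 with ⟨h1, -⟩ | ⟨h1, h2⟩
    · exact Or.inl ((ZMod.intCast_eq_intCast_iff_dvd_sub _ _ _).1 h1)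
    · exact Or.inr ⟨(ZMod.intCast_eq_intCast_iff_dvd_sub _ _ _).1 h1,
        (ZMod.intCast_eq_intCast_iff_dvd_sub _ _ _).1 h2.symm⟩
  obtain ⟨t, ht⟩ : (n : ℤ) ∣ y ⟨0, by omega⟩ - x ⟨0, by omega⟩ := by
    -- Exchanged ends of the chord `0` would make `n` divide `4`.
    refine (h ⟨0, by omega⟩).resolve_right fun ⟨h1, h2⟩ => ?_
    have h3 := Int.le_of_dvd (by simp only [Nat.cast_zero]; omega) (dvd_add h1 h2)
    simp only [Nat.cast_zero] at h3
    omega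
  refine ⟨t, fun i => ?_⟩
  have hx0 := hx ⟨0, by omega⟩ i (Fin.mk_le_mk.2 (Nat.zero_le _))
  have hy0 := hy ⟨0, by omega⟩ i (Fin.mk_le_mk.2 (Nat.zero_le _))
  simp only [Nat.cast_zero] at hx0 hy0
  have hi := i.isLt
  have hd : (n : ℤ) ∣ n * t := dvd_mul_right _ _
  rcases h i with h1 | ⟨h1, h2⟩
  · have h2 := Int.eq_zero_of_abs_lt_dvd (dvd_sub h1 hd) (by rw [abs_lt]; omega)
    omega
  · have h3 := Int.le_of_dvd (by omega) (dvd_sub h1 hd)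
    have h4 := Int.le_of_dvd (by omega) (dvd_add h2 hd)
    omega

/-- By nesting, the two other sides of the triangle are not both chords, so one is a side of the
polygon at an end of the interval `k`. This leaves two inner and two outer positions for `c`, each
of which determines the neighbouring interval if there is one. -/
theorem third_vertex (hn : 4 < n) (hx : IsArcSeq x) (hA : Represents x A) (k : Fin (n - 3))
    (c : ZMod n) (h : IsTriangle (Set.range A.chord) (x k : ZMod n)
      ((x k + k.val + 2 : ℤ) : ZMod n) c) :
    (((c = (x k + 1 : ℤ) ∧ ∀ j : Fin (n - 3), j.val + 1 = k.val → x j = x k + 1) ∨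
      (c = (x k + k.val + 1 : ℤ) ∧ ∀ j : Fin (n - 3), j.val + 1 = k.val → x j = x k)) ∨
    ((c = (x k + k.val + 3 : ℤ) ∧ ∀ j : Fin (n - 3), j.val = k.val + 1 → x j = x k) ∨
      (c = (x k - 1 : ℤ) ∧ ∀ j : Fin (n - 3), j.val = k.val + 1 → x j = x k - 1))) := by
  have : NeZero n := ⟨by omega⟩
  set z := x (lastIndex hn) with hz
  have hb := hx.bounds hn k
  rw [← hz] at hb
  obtain ⟨-, -, -, -, hbc, hac⟩ := h
  have pa := pos_intCast (n := n) (y := x k) z (by omega) (by omega)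
  have pb := pos_intCast (n := n) (y := x k + k.val + 2) z (by omega) (by omega)
  have c0 := pos_nonneg z c
  have c1 := pos_lt z c
  have mem : ∀ a b, s(a, b) ∈ Set.range A.chord → ∃ j : Fin (n - 3),
      (pos z a = x j - z ∧ pos z b = x j - z + j.val + 2) ∨
      (pos z b = x j - z ∧ pos z a = x j - z + j.val + 2) := by
    rintro a b ⟨j, hj⟩
    rw [hA] at hj
    exact ⟨j, (hx.arc_eq_iff hn j a b).1 hj⟩
  have hk := fun j => hx.nested j k
  have key : (pos z c = x k + 1 - z ∧ ∀ j : Fin (n - 3), j.val + 1 = k.val → x j = x k + 1) ∨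
      (pos z c = x k + k.val + 1 - z ∧ ∀ j : Fin (n - 3), j.val + 1 = k.val → x j = x k) ∨
      (pos z c = x k + k.val + 3 - z ∧ ∀ j : Fin (n - 3), j.val = k.val + 1 → x j = x k) ∨
      (pos z c = x k - 1 - z ∧ ∀ j : Fin (n - 3), j.val = k.val + 1 → x j = x k - 1) := by
    rw [isSide_iff z, pb] at hbc
    rw [isSide_iff z, pa] at hac
    rcases hbc with hbc | hbc <;> rcases hac with hac | hac
    · rcases (show pos z c = x k + 1 - z ∨ pos z c = x k + k.val + 3 - z by omega) with h | h
      · exact Or.inl ⟨h, fun j hj => by have := hk j; omega⟩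
      · exact Or.inr (Or.inr (Or.inl ⟨h, fun j hj => by have := hk j; have := j.isLt; omega⟩))
    · obtain ⟨l, hl⟩ := mem _ _ hac
      rw [pa] at hl
      have hkl := hk l
      rcases (show pos z c = x k + k.val + 1 - z ∨ pos z c = x k + k.val + 3 - z by omega)
        with h | h
      · exact Or.inr (Or.inl ⟨h, fun j hj => by have := hx.nested j l; omega⟩)
      · exact Or.inr (Or.inr (Or.inl ⟨h, fun j hj => by have := hx.nested j l; omega⟩))
    · obtain ⟨l, hl⟩ := mem _ _ hbc
      rw [pb] at hl
      have hkl := hk l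
      have hbl := hx.bounds hn l
      rw [← hz] at hbl
      rcases (show pos z c = x k + 1 - z ∨ pos z c = x k - 1 - z by omega)
        with h | h
      · exact Or.inl ⟨h, fun j hj => by have := hx.nested j l; omega⟩
      · exact Or.inr (Or.inr (Or.inr ⟨h, fun j hj => by have := hx.nested j l; omega⟩))
    · obtain ⟨l, hl⟩ := mem _ _ hbc
      obtain ⟨l', hl'⟩ := mem _ _ hac
      rw [pb] at hl
      rw [pa] at hl'
      have hkl := hk l
      have hkl' := hk l'
      have hll := hx.nested l l'
      omega
  have cast : ∀ w : ℤ, pos z c = w - z → c = (w : ZMod n) := by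
    intro w hw
    apply pos_injective z
    rw [pos_intCast z (by omega) (by omega), hw]
  rcases key with ⟨h1, h2⟩ | ⟨h1, h2⟩ | ⟨h1, h2⟩ | ⟨h1, h2⟩
  · exact Or.inl (Or.inl ⟨cast _ h1, h2⟩)
  · exact Or.inl (Or.inr ⟨cast _ h1, h2⟩)
  · exact Or.inr (Or.inl ⟨cast _ h1, h2⟩)
  · exact Or.inr (Or.inr ⟨cast _ h1, h2⟩)

end Represents

/-- Nesting only has to be checked against the two neighbours; the other inequalities follow by
transitivity. -/
theorem IsArcSeq.update {m : ℕ} {x : Fin m → ℤ} (hx : IsArcSeq x) (k : Fin m) (w : ℤ)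
    (h1 : ∀ j : Fin m, j.val + 1 = k.val → w ≤ x j ∧ x j ≤ w + 1)
    (h2 : ∀ j : Fin m, j.val = k.val + 1 → x j ≤ w ∧ w ≤ x j + 1) :
    IsArcSeq (Function.update x k w) := by
  intro i j hij
  have hij' : i.val ≤ j.val := hij
  have hi := i.isLt
  have hj := j.isLt
  rw [Function.update_apply, Function.update_apply]
  split_ifs with hjk hik hik
  · subst hik hjk; omega
  · subst hjk
    have hne : i.val ≠ j.val := fun h => hik (Fin.ext h)
    have h3 := h1 ⟨j.val - 1, by omega⟩ (by simp only; omega)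
    have h4 := hx i ⟨j.val - 1, by omega⟩ (Fin.mk_le_mk.2 (by omega))
    simp only at h4
    omega
  · subst hik
    have hne : j.val ≠ i.val := fun h => hjk (Fin.ext h)
    have h3 := h2 ⟨i.val + 1, by omega⟩ rfl
    have h4 := hx ⟨i.val + 1, by omega⟩ j (Fin.mk_le_mk.2 (by omega))
    push_cast at h4
    omega
  · exact hx i j hij

namespace Represents

variable {n : ℕ} {x y : Fin (n - 3) → ℤ} {A B : CTFT n}

theorem mem_range (hA : Represents x A) (i : Fin (n - 3)) {a b : ZMod n} {u v : ℤ}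
    (hu : u = x i) (hv : v = x i + i.val + 2) (ha : a = u) (hb : b = v) :
    s(a, b) ∈ Set.range A.chord :=
  ⟨i, by rw [hA, arc, ha, hb, hu, hv]⟩

/-- The flipped chord joins an inner to an outer third vertex. If these lie at opposite ends of the
interval, it moves by one. If they lie at the same end, the new chord and the chords `k - 1`, `k +
1` would bound an internal triangle, except when `k` is extremal and its two inner or two outer
candidates are the same vertex. -/
theorem of_isFlip (hn : 4 < n) (hx : IsArcSeq x) (hA : Represents x A) {k : Fin (n - 3)}
    (h : IsFlip A k B) :
    ∃ y, IsArcSeq y ∧ Represents y B ∧ (IncrementsAt k x y ∨ IncrementsAt k y x) := by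
  have hfin : ∀ c d : ZMod n, ∀ w : ℤ, B.chord = Function.update A.chord k s(c, d) →
      s(c, d) = arc n k.val w → Represents (Function.update x k w) B := by
    intro c d w hB hw i
    rw [hB, Function.update_apply, Function.update_apply]
    split_ifs with hi
    · rw [hw, hi]
    · exact hA i
  have up : ∀ c d : ZMod n, B.chord = Function.update A.chord k s(c, d) →
      (c = (x k + 1 : ℤ) ∧ ∀ j : Fin (n - 3), j.val + 1 = k.val → x j = x k + 1) →
      (d = (x k + k.val + 3 : ℤ) ∧ ∀ j : Fin (n - 3), j.val = k.val + 1 → x j = x k) →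
      ∃ y, IsArcSeq y ∧ Represents y B ∧ (IncrementsAt k x y ∨ IncrementsAt k y x) := by
    rintro c d hB ⟨hc, h1⟩ ⟨hd, h2⟩
    refine ⟨Function.update x k (x k + 1), hx.update k _ ?_ ?_, hfin c d _ hB ?_, Or.inl rfl⟩
    · intro j hj
      have := h1 j hj
      omega
    · intro j hj
      have := h2 j hj
      omega
    · rw [hc, hd, arc, show x k + 1 + k.val + 2 = x k + k.val + 3 by ring]
  have down : ∀ c d : ZMod n, B.chord = Function.update A.chord k s(c, d) →
      (c = (x k + k.val + 1 : ℤ) ∧ ∀ j : Fin (n - 3), j.val + 1 = k.val → x j = x k) →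
      (d = (x k - 1 : ℤ) ∧ ∀ j : Fin (n - 3), j.val = k.val + 1 → x j = x k - 1) →
      ∃ y, IsArcSeq y ∧ Represents y B ∧ (IncrementsAt k x y ∨ IncrementsAt k y x) := by
    rintro c d hB ⟨hc, h1⟩ ⟨hd, h2⟩
    refine ⟨Function.update x k (x k - 1), hx.update k _ ?_ ?_, hfin c d _ hB ?_, Or.inr ?_⟩
    · intro j hj
      have := h1 j hj
      omega
    · intro j hj
      have := h2 j hj
      omega
    · rw [hc, hd, arc, show x k - 1 + k.val + 2 = x k + k.val + 1 by ring, Sym2.eq_swap]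
    · simp [IncrementsAt]
  -- Only one vertex lies outside the outermost interval, so its two outer candidates agree modulo
  -- `n`.
  have wrap : ((x k + k.val + 3 : ℤ) : ZMod n) = ((x k - 1 : ℤ) : ZMod n) ∨ k.val + 1 < n - 3 := by
    rcases Nat.lt_or_ge (k.val + 1) (n - 3) with h | h
    · exact Or.inr h
    · left
      have hk := k.isLt
      rw [show x k + k.val + 3 = x k - 1 + n by omega]
      push_cast
      rw [ZMod.natCast_self, add_zero]
  have hfree : ∀ c d v : ZMod n, B.chord = Function.update A.chord k s(c, d) →
      ∀ i j : Fin (n - 3), i ≠ k → j ≠ k → A.chord i = s(c, v) → A.chord j = s(d, v) → False := by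
    intro c d v hB i j hi hj hci hdj
    refine B.not_internal (a := c) (b := d) (c := v) ⟨k, ?_⟩ ⟨j, ?_⟩ ⟨i, ?_⟩
    · rw [hB, Function.update_self]
    · rw [hB, Function.update_of_ne hj, hdj]
    · rw [hB, Function.update_of_ne hi, hci]
  have main : ∀ c d : ZMod n, B.chord = Function.update A.chord k s(c, d) →
      ((c = (x k + 1 : ℤ) ∧ ∀ j : Fin (n - 3), j.val + 1 = k.val → x j = x k + 1) ∨
      (c = (x k + k.val + 1 : ℤ) ∧ ∀ j : Fin (n - 3), j.val + 1 = k.val → x j = x k)) →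
      ((d = (x k + k.val + 3 : ℤ) ∧ ∀ j : Fin (n - 3), j.val = k.val + 1 → x j = x k) ∨
      (d = (x k - 1 : ℤ) ∧ ∀ j : Fin (n - 3), j.val = k.val + 1 → x j = x k - 1)) →
      ∃ y, IsArcSeq y ∧ Represents y B ∧ (IncrementsAt k x y ∨ IncrementsAt k y x) := by
    intro c d hB hc hd
    rcases hc with hc | hc <;> rcases hd with hd | hd
    · exact up c d hB hc hd
    · by_cases hk : k.val = 0
      · refine down c d hB ⟨?_, fun j hj => by omega⟩ hd
        rw [hc.1, hk, Nat.cast_zero, add_zero]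
      · rcases wrap with hw | hw
        · refine up c d hB hc ⟨hd.1.trans hw.symm, fun j hj => ?_⟩
          have h5 := j.isLt
          exfalso
          have h6 := (ZMod.intCast_eq_intCast_iff_dvd_sub _ _ _).1 hw.symm
          have h7 := Int.le_of_dvd (by omega) h6
          omega
        · exfalso
          refine hfree c d (x k + k.val + 2 : ℤ) hB ⟨k.val - 1, by omega⟩ ⟨k.val + 1, hw⟩
            (fun h => ?_) (fun h => ?_) ?_ ?_
          · have := congrArg Fin.val h; simp only at this; omega
          · have := congrArg Fin.val h; simp only at this; omega
          · rw [hA, arc, hc.2 _ (by simp only; omega), hc.1]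
            congr 3; simp only; omega
          · rw [hA, arc, hd.2 _ rfl, hd.1]
            congr 3; push_cast; omega
    · by_cases hk : k.val = 0
      · refine up c d hB ⟨?_, fun j hj => by omega⟩ hd
        rw [hc.1, hk, Nat.cast_zero, add_zero]
      · rcases wrap with hw | hw
        · refine down c d hB hc ⟨hd.1.trans hw, fun j hj => ?_⟩
          have h5 := j.isLt
          exfalso
          have h6 := (ZMod.intCast_eq_intCast_iff_dvd_sub _ _ _).1 hw.symm
          have h7 := Int.le_of_dvd (by omega) h6
          omega
        · exfalso
          refine hfree c d (x k : ℤ) hB ⟨k.val - 1, by omega⟩ ⟨k.val + 1, hw⟩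
            (fun h => ?_) (fun h => ?_) ?_ ?_
          · have := congrArg Fin.val h; simp only at this; omega
          · have := congrArg Fin.val h; simp only at this; omega
          · rw [hA, arc, hc.2 _ (by simp only; omega), hc.1, Sym2.eq_iff]
            exact Or.inr ⟨rfl, by congr 1; simp only; omega⟩
          · rw [hA, arc, hd.2 _ rfl, hd.1, Sym2.eq_iff]
            exact Or.inr ⟨rfl, by congr 1; push_cast; ring⟩
    · exact down c d hB hc hd
  obtain ⟨a, b, c, d, hab, hcd, h1, h2, hB⟩ := h
  have htri : ∀ v, IsTriangle (Set.range A.chord) a b v →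
      IsTriangle (Set.range A.chord) (x k : ZMod n) ((x k + k.val + 2 : ℤ) : ZMod n) v := by
    intro v hv
    rw [hA, arc, Sym2.eq_iff] at hab
    rcases hab with ⟨e1, e2⟩ | ⟨e1, e2⟩
    · rwa [e1, e2]
    · rw [e1, e2]; exact hv.swap
  have inner : k.val = 0 ∨ ∃ j : Fin (n - 3), j.val + 1 = k.val := by
    rcases Nat.eq_zero_or_pos k.val with h | h
    · exact Or.inl h
    · exact Or.inr ⟨⟨k.val - 1, by omega⟩, by simp only; omega⟩
  rcases third_vertex hn hx hA k c (htri c h1) with hc | hc <;>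
    rcases third_vertex hn hx hA k d (htri d h2) with hd | hd
  · exfalso
    apply hcd
    rcases inner with h | ⟨j, hj⟩
    · rw [h, Nat.cast_zero, add_zero] at hc hd
      exact (hc.elim And.left And.left).trans (hd.elim And.left And.left).symm
    · rcases hc with ⟨hc, hc'⟩ | ⟨hc, hc'⟩ <;> rcases hd with ⟨hd, hd'⟩ | ⟨hd, hd'⟩
      · rw [hc, hd]
      · have := hc' j hj; have := hd' j hj; omega
      · have := hc' j hj; have := hd' j hj; omega
      · rw [hc, hd]
  · exact main c d hB hc hd
  · rw [Sym2.eq_swap] at hB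
    exact main d c hB hd hc
  · exfalso
    apply hcd
    rcases wrap with h | h
    · rw [h] at hc hd
      exact (hc.elim And.left And.left).trans (hd.elim And.left And.left).symm
    · rcases hc with ⟨hc, hc'⟩ | ⟨hc, hc'⟩ <;> rcases hd with ⟨hd, hd'⟩ | ⟨hd, hd'⟩
      · rw [hc, hd]
      · have := hc' ⟨_, h⟩ rfl; have := hd' ⟨_, h⟩ rfl; omega
      · have := hc' ⟨_, h⟩ rfl; have := hd' ⟨_, h⟩ rfl; omega
      · rw [hc, hd]

/-- Adding one to one entry of the sequence is a flip. -/
theorem isFlip (hn : 4 < n) (hx : IsArcSeq x) (hy : IsArcSeq y) (hA : Represents x A)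
    (hB : Represents y B) {k : Fin (n - 3)} (h : IncrementsAt k x y) : IsFlip A k B := by
  have : NeZero n := ⟨by omega⟩
  have hk := k.isLt
  have hself : y k = x k + 1 := by rw [h, Function.update_self]
  have hother : ∀ i, i ≠ k → y i = x i := fun i hi => by rw [h, Function.update_of_ne hi]
  set z := x (lastIndex hn) with hz
  have hb := hx.bounds hn k
  rw [← hz] at hb
  have pa := pos_intCast (n := n) (y := x k) z (by omega) (by omega)
  have pb := pos_intCast (n := n) (y := x k + k.val + 2) z (by omega) (by omega)
  have pc := pos_intCast (n := n) (y := x k + 1) z (by omega) (by omega)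
  have pd := pos_intCast (n := n) (y := x k + k.val + 3) z (by omega) (by omega)
  have hne : ∀ v w : ZMod n, pos z v ≠ pos z w → v ≠ w := fun v w h1 h2 => h1 (by rw [h2])
  have hab : s((x k : ZMod n), ((x k + k.val + 2 : ℤ) : ZMod n)) ∈ Set.range A.chord :=
    ⟨k, hA k⟩
  refine ⟨(x k : ℤ), (x k + k.val + 2 : ℤ), (x k + 1 : ℤ), (x k + k.val + 3 : ℤ), hA k,
    hne _ _ (by omega),
    ⟨hne _ _ (by omega), hne _ _ (by omega), hne _ _ (by omega), Or.inr hab, ?_, Or.inl ?_⟩,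
    ⟨hne _ _ (by omega), hne _ _ (by omega), hne _ _ (by omega), Or.inr hab, Or.inl ?_, ?_⟩, ?_⟩
  · rcases Nat.eq_zero_or_pos k.val with h0 | h0
    · left
      rw [isSide_iff z]
      omega
    · right
      -- Nesting both before and after the step forces the interval `k - 1` to start at `x k + 1`.
      have h1 := hx ⟨k.val - 1, by omega⟩ k (Fin.mk_le_mk.2 (by omega))
      have h2 := hy ⟨k.val - 1, by omega⟩ k (Fin.mk_le_mk.2 (by omega))
      rw [hself, hother _ (fun hc => by have := congrArg Fin.val hc; simp only at this; omega)]
        at h2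
      simp only at h1 h2
      rw [Sym2.eq_swap]
      exact hA.mem_range ⟨k.val - 1, by omega⟩ (u := x k + 1) (v := x k + k.val + 2)
        (by omega) (by simp only; omega) rfl rfl
  · rw [isSide_iff z]
    omega
  · rw [isSide_iff z]
    omega
  · rcases Nat.lt_or_ge (k.val + 1) (n - 3) with h0 | h0
    · right
      have h1 := hx k ⟨k.val + 1, h0⟩ (Fin.mk_le_mk.2 (by omega))
      have h2 := hy k ⟨k.val + 1, h0⟩ (Fin.mk_le_mk.2 (by omega))
      rw [hself, hother _ (fun hc => by have := congrArg Fin.val hc; simp only at this; omega)]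
        at h2
      push_cast at h1 h2
      exact hA.mem_range ⟨k.val + 1, h0⟩ (u := x k) (v := x k + k.val + 3)
        (by omega) (by push_cast; omega) rfl rfl
    · left
      have : x k = z := by
        rw [hz]
        congr 1
        apply Fin.ext
        simp only [lastIndex]
        omega
      rw [isSide_iff z]
      omega
  · funext i
    by_cases hi : i = k
    · subst hi
      rw [Function.update_self, hB, arc, hself, show x i + 1 + i.val + 2 = x i + i.val + 3 by ring]
    · rw [Function.update_of_ne hi, hB, hA, hother i hi]

end Represents


/-! ### Reflection, and sums along paths -/

section sequences

variable {m : ℕ} {x y : Fin m → ℤ}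

/-- The sequence of the triangulation obtained by a reflection of the polygon and a reversal of the
labelling. -/
def reflect (x : Fin m → ℤ) : Fin m → ℤ := fun i => -x i.rev

theorem reflect_reflect (x : Fin m → ℤ) : reflect (reflect x) = x := by
  funext i
  simp [reflect]

theorem reflect_zero : reflect (0 : Fin m → ℤ) = 0 := by
  funext i
  simp [reflect]

theorem IsArcSeq.reflect (hx : IsArcSeq x) : IsArcSeq (reflect x) := by
  intro i j hij
  have h := hx j.rev i.rev (Fin.rev_le_rev.2 hij)
  simp only [Fin.val_rev, TFT.reflect] at *
  omega

theorem IncrementsAt.reflect {k : Fin m} (h : IncrementsAt k x y) :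
    IncrementsAt k.rev (reflect y) (reflect x) := by
  subst h
  funext i
  by_cases hi : i = k.rev
  · subst hi
    simp [TFT.reflect]
  · have hi' : i.rev ≠ k := fun h => hi (by rw [← h, Fin.rev_rev])
    simp [TFT.reflect, Function.update_of_ne hi, Function.update_of_ne hi']

theorem sum_reflect (x : Fin m → ℤ) : ∑ i, reflect x i = -∑ i, x i := by
  simp only [reflect, Finset.sum_neg_distrib]
  rw [← Equiv.sum_comp Fin.revPerm x]
  rfl

theorem IncrementsAt.sum {k : Fin m} (h : IncrementsAt k x y) : ∑ i, y i = ∑ i, x i + 1 := by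
  rw [h, Finset.sum_update_of_mem (Finset.mem_univ k),
    Finset.sum_eq_add_sum_sdiff_singleton_of_mem (Finset.mem_univ k) x]
  ring

theorem IsIncreasingPath.sum {N : ℕ} {X : ℕ → Fin m → ℤ} (h : IsIncreasingPath m N X) :
    ∀ j ≤ N, ∑ i, X j i = j := by
  intro j
  induction j with
  | zero => simp [h.zero]
  | succ j ih =>
    intro hj
    obtain ⟨k, hk⟩ := h.step j hj
    rw [hk.sum, ih (by omega)]
    push_cast
    rfl

/-- Consecutive members of `X` differ by one in one entry. -/
structure IsPath (m L : ℕ) (X : ℕ → Fin m → ℤ) : Prop where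
  zero : X 0 = 0
  arcSeq : ∀ j ≤ L, IsArcSeq (X j)
  step : ∀ j < L, ∃ k, IncrementsAt k (X j) (X (j + 1)) ∨ IncrementsAt k (X (j + 1)) (X j)

namespace IsPath

variable {L : ℕ} {X : ℕ → Fin m → ℤ}

theorem sum_step (h : IsPath m L X) (j : ℕ) (hj : j < L) :
    ∑ i, X (j + 1) i = ∑ i, X j i + 1 ∨ ∑ i, X (j + 1) i = ∑ i, X j i - 1 := by
  obtain ⟨k, hk | hk⟩ := h.step j hj
  · exact Or.inl hk.sum
  · have := hk.sum
    omega

theorem abs_sum_le (h : IsPath m L X) (j : ℕ) (hj : j ≤ L) :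
    -(j : ℤ) ≤ ∑ i, X j i ∧ ∑ i, X j i ≤ j := by
  induction j with
  | zero => simp [h.zero]
  | succ j ih =>
    have := ih (by omega)
    have := h.sum_step j hj
    omega

theorem le_sum_add (h : IsPath m L X) (j : ℕ) (hj : j ≤ L) :
    ∑ i, X L i ≤ ∑ i, X j i + (L - j) := by
  induction hj using Nat.decreasingInduction with
  | self => omega
  | of_succ j hj ih =>
    have := h.sum_step j hj
    omega

theorem reflect (h : IsPath m L X) : IsPath m L (fun j => reflect (X j)) where
  zero := by simp only [h.zero, reflect_zero]
  arcSeq := fun j hj => (h.arcSeq j hj).reflect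
  step := fun j hj => by
    obtain ⟨k, hk | hk⟩ := h.step j hj
    exacts [⟨k.rev, Or.inr hk.reflect⟩, ⟨k.rev, Or.inl hk.reflect⟩]

/-- The sum has to climb from `0` to the number of steps, so no step can be a decrement. -/
theorem isIncreasingPath (h : IsPath m (staircase m).card X)
    (hlast : X (staircase m).card = topSeq m) : IsIncreasingPath m (staircase m).card X where
  zero := h.zero
  last := hlast
  arcSeq := h.arcSeq
  step := fun j hj => by
    obtain ⟨k, hk | hk⟩ := h.step j hj
    · exact ⟨k, hk⟩
    · have h1 := (h.abs_sum_le j hj.le).2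
      have h2 := h.le_sum_add (j + 1) hj
      have h3 := hk.sum
      rw [hlast, sum_topSeq] at h2
      push_cast at h2
      omega

end IsPath

/-- The sequence itself or its reflection. -/
def orient (b : Bool) (x : Fin m → ℤ) : Fin m → ℤ := if b then x else reflect x

theorem orient_injective (b : Bool) : Function.Injective (orient (m := m) b) := by
  cases b
  · exact Function.LeftInverse.injective (g := reflect) reflect_reflect
  · exact Function.injective_id

theorem IsArcSeq.orient (b : Bool) (hx : IsArcSeq x) : IsArcSeq (orient b x) := by
  cases b
  · exact hx.reflect
  · exact hx

theorem sum_orient (b : Bool) (x : Fin m → ℤ) :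
    ∑ i, orient b x i = if b then ∑ i, x i else -∑ i, x i := by
  cases b
  · exact sum_reflect x
  · rfl

end sequences

/-! ### Lifting walks, the distance and the geodesics -/

theorem exists_walk_of_getVert {V : Type*} {G : SimpleGraph V} (N : ℕ) (f : ℕ → V)
    (h : ∀ j < N, G.Adj (f j) (f (j + 1))) :
    ∃ p : G.Walk (f 0) (f N), p.length = N ∧ ∀ j ≤ N, p.getVert j = f j := by
  induction N generalizing f with
  | zero => exact ⟨.nil, rfl, fun j hj => by rw [Nat.le_zero.1 hj]; rfl⟩
  | succ N ih =>
    obtain ⟨p, hp, hv⟩ := ih (fun j => f (j + 1)) fun j hj => h (j + 1) (by omega)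
    refine ⟨.cons (h 0 (by omega)) p, by rw [SimpleGraph.Walk.length_cons, hp], fun j hj => ?_⟩
    cases j with
    | zero => rfl
    | succ j => exact hv j (by omega)

section walks

variable {n : ℕ}

theorem represents_star (hn : 4 < n) : Represents 0 (star n hn) := by
  intro i
  simp [star, arc]

theorem represents_starReverse (hn : 4 < n) : Represents (topSeq (n - 3)) (starReverse n hn) := by
  intro i
  have hi := i.isLt
  have h1 : (star n hn).chord i.rev = arc n i.rev.val 0 := represents_star hn i.rev
  change (star n hn).chord i.rev = _
  rw [h1, arc, arc, Sym2.eq_swap]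
  have h2 : (0 : ℤ) + i.rev.val + 2 = topSeq (n - 3) i := by
    simp only [Fin.val_rev, topSeq]
    omega
  have h3 : topSeq (n - 3) i + i.val + 2 = n := by
    simp only [topSeq]
    omega
  rw [h2, h3]
  simp

theorem Represents.add_mul {x : Fin (n - 3) → ℤ} {A : CTFT n} (h : Represents x A) (t : ℤ) :
    Represents (fun i => x i + n * t) A := by
  intro i
  rw [h i, arc, arc]
  simp

theorem reflect_topSeq (i : Fin (n - 3)) :
    reflect (topSeq (n - 3)) i = topSeq (n - 3) i + n * (-1) := by
  have hi := i.isLt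
  simp only [reflect, topSeq, Fin.val_rev]
  omega

theorem represents_orient_topSeq (hn : 4 < n) (b : Bool) :
    Represents (orient b (topSeq (n - 3))) (starReverse n hn) := by
  cases b
  · have h : orient false (topSeq (n - 3)) = fun i => topSeq (n - 3) i + n * (-1) :=
      funext reflect_topSeq
    rw [h]
    exact (represents_starReverse hn).add_mul _
  · exact represents_starReverse hn

/-- Translating the `n - 3` entries by `n` adds `n (n - 3)`, which is twice the number of cells.
This equality makes the two nearest lifts of the reversed star equally distant from `0`. -/
theorem sum_add_mul (hn : 4 < n) {x y : Fin (n - 3) → ℤ} {t : ℤ} (h : ∀ i, y i = x i + n * t) :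
    ∑ i, y i = ∑ i, x i + 2 * ((staircase (n - 3)).card * t) := by
  have h1 := two_mul_card_staircase (n - 3)
  zify at h1
  have h2 : ((n - 3 : ℕ) : ℤ) = n - 3 := by omega
  simp only [h, Finset.sum_add_distrib, Finset.sum_const, Finset.card_univ, Fintype.card_fin,
    nsmul_eq_mul]
  rw [← mul_assoc 2, h1, h2]
  ring

theorem two_le_card_staircase (hn : 4 < n) : 2 ≤ (staircase (n - 3)).card := by
  have h1 := two_mul_card_staircase (n - 3)
  have : 2 * 2 ≤ (n - 3) * (n - 3 + 3) := Nat.mul_le_mul (by omega) (by omega)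
  omega

theorem exists_lift (hn : 4 < n) {A B : CTFT n} (p : (flipGraph n).Walk A B)
    {x : Fin (n - 3) → ℤ} (hx : IsArcSeq x) (hA : Represents x A) :
    ∃ X : ℕ → Fin (n - 3) → ℤ, X 0 = x ∧
      (∀ j ≤ p.length, IsArcSeq (X j) ∧ Represents (X j) (p.getVert j)) ∧
      ∀ j < p.length, ∃ k, IncrementsAt k (X j) (X (j + 1)) ∨ IncrementsAt k (X (j + 1)) (X j) := by
  induction p generalizing x with
  | nil => exact ⟨fun _ => x, rfl, fun j _ => ⟨hx, by simpa using hA⟩, fun j hj => by simp at hj⟩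
  | cons h p ih =>
    obtain ⟨k, hk⟩ := flipGraph_adj.1 h
    obtain ⟨y, hy, hB, hxy⟩ := hA.of_isFlip hn hx hk
    obtain ⟨X, h0, h1, h2⟩ := ih hy hB
    refine ⟨fun j => Nat.casesOn j x X, rfl, fun j hj => ?_, fun j hj => ?_⟩
    · cases j with
      | zero => exact ⟨hx, hA⟩
      | succ j => exact h1 j (Nat.succ_le_succ_iff.1 hj)
    · cases j with
      | zero => exact ⟨k, by subst h0; exact hxy⟩
      | succ j => exact h2 j (Nat.succ_lt_succ_iff.1 hj)

theorem exists_lift_star (hn : 4 < n) (p : (flipGraph n).Walk (star n hn) (starReverse n hn)) :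
    ∃ X : ℕ → Fin (n - 3) → ℤ, IsPath (n - 3) p.length X ∧
      (∀ j ≤ p.length, Represents (X j) (p.getVert j)) ∧
      ∃ t : ℤ, ∀ i, X p.length i = topSeq (n - 3) i + n * t := by
  obtain ⟨X, h0, h1, h2⟩ := exists_lift hn p (x := 0) (fun i j h => by simpa using h)
    (represents_star hn)
  refine ⟨X, ⟨h0, fun j hj => (h1 j hj).1, h2⟩, fun j hj => (h1 j hj).2, ?_⟩
  obtain ⟨hX, hr⟩ := h1 _ le_rfl
  rw [SimpleGraph.Walk.getVert_length] at hr
  refine (represents_starReverse hn).shift hn ?_ hX hr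
  intro i j hij
  have : i.val ≤ j.val := hij
  simp only [topSeq]
  omega

/-- The lift ends at a sequence whose sum is an odd multiple of the number of cells, and each step
changes the sum by one. -/
theorem card_staircase_le_length (hn : 4 < n)
    (p : (flipGraph n).Walk (star n hn) (starReverse n hn)) :
    (staircase (n - 3)).card ≤ p.length := by
  obtain ⟨X, hX, -, t, ht⟩ := exists_lift_star hn p
  have h1 := sum_add_mul hn ht
  rw [sum_topSeq] at h1
  have h2 := hX.abs_sum_le _ le_rfl
  rcases lt_or_ge t 0 with h | h
  · have := mul_le_mul_of_nonneg_left (show t ≤ -1 by omega)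
      (Int.natCast_nonneg (staircase (n - 3)).card)
    omega
  · have := mul_nonneg (Int.natCast_nonneg (staircase (n - 3)).card) h
    omega

theorem exists_walk_of_tableau (hn : 4 < n) (b : Bool) (Y : StandardTableau (staircase (n - 3))) :
    ∃ p : (flipGraph n).Walk (star n hn) (starReverse n hn),
      p.length = (staircase (n - 3)).card ∧
      ∀ j ≤ (staircase (n - 3)).card, Represents (orient b (Y.path j)) (p.getVert j) := by
  have hm : 2 ≤ n - 3 := by omega
  have harc := fun j => (Y.path_isArcSeq hm j).orient b
  let f : ℕ → CTFT n := fun j => ofArcSeq hn _ (harc j)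
  have hf : ∀ j, Represents (orient b (Y.path j)) (f j) := fun j i => rfl
  have hadj : ∀ j < (staircase (n - 3)).card, (flipGraph n).Adj (f j) (f (j + 1)) := by
    intro j hj
    obtain ⟨k, hk⟩ := (Y.isIncreasingPath_path hm).step j hj
    rw [flipGraph_adj]
    cases b
    · exact ⟨k.rev, ((hf (j + 1)).isFlip hn (harc _) (harc _) (hf j) hk.reflect).symm⟩
    · exact ⟨k, (hf j).isFlip hn (harc _) (harc _) (hf (j + 1)) hk⟩
  obtain ⟨p, hp, hv⟩ := exists_walk_of_getVert _ f hadj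
  have e0 : f 0 = star n hn := by
    refine (hf 0).unique ?_
    rw [Y.path_zero]
    cases b
    · have : orient false (0 : Fin (n - 3) → ℤ) = 0 := reflect_zero
      rw [this]
      exact represents_star hn
    · exact represents_star hn
  have e1 : f (staircase (n - 3)).card = starReverse n hn := by
    refine (hf _).unique ?_
    rw [Y.path_last]
    exact represents_orient_topSeq hn b
  refine ⟨p.copy e0 e1, by simpa using hp, fun j hj => ?_⟩
  rw [SimpleGraph.Walk.getVert_copy, hv j hj]
  exact hf j

theorem dist_star_starReverse (hn : 4 < n) :
    (flipGraph n).dist (star n hn) (starReverse n hn) = (staircase (n - 3)).card := by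
  -- A walk must exist: for unreachable vertices `dist` would have the default value `0`.
  obtain ⟨Y⟩ := nonempty_standardTableau (staircase (n - 3))
  obtain ⟨p, hp, -⟩ := exists_walk_of_tableau hn true Y
  apply le_antisymm
  · rw [← hp]
    exact SimpleGraph.dist_le p
  · obtain ⟨q, hq⟩ := p.reachable.exists_walk_length_eq_dist
    rw [← hq]
    exact card_staircase_le_length hn q

theorem Geodesic.length (hn : 4 < n) (u : Geodesic (star n hn) (starReverse n hn)) :
    u.1.length = (staircase (n - 3)).card :=
  u.2.trans (dist_star_starReverse hn)

/-- The geodesic that flips the diagonals in the order given by a tableau, or its reflection. -/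
theorem exists_geodesic_of_tableau (hn : 4 < n) (q : Bool × StandardTableau (staircase (n - 3))) :
    ∃ u : Geodesic (star n hn) (starReverse n hn), ∀ j ≤ (staircase (n - 3)).card,
      Represents (orient q.1 (q.2.path j)) (u.1.getVert j) := by
  obtain ⟨p, hp, hv⟩ := exists_walk_of_tableau hn q.1 q.2
  exact ⟨⟨p, hp.trans (dist_star_starReverse hn).symm⟩, hv⟩

theorem exists_tableau_of_geodesic (hn : 4 < n) (u : Geodesic (star n hn) (starReverse n hn)) :
    ∃ q : Bool × StandardTableau (staircase (n - 3)), ∀ j ≤ (staircase (n - 3)).card,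
      Represents (orient q.1 (q.2.path j)) (u.1.getVert j) := by
  obtain ⟨X, hX, hr, t, ht⟩ := exists_lift_star hn u.1
  rw [u.length] at hX hr ht
  have hm : 2 ≤ n - 3 := by omega
  have h1 := sum_add_mul hn ht
  rw [sum_topSeq] at h1
  have h2 := hX.abs_sum_le _ le_rfl
  have h3 := two_le_card_staircase hn
  have hN := Int.natCast_nonneg (staircase (n - 3)).card
  -- Within `N` steps the sum `(2 t + 1) N` is attainable only for these two lifts.
  have htt : t = 0 ∨ t = -1 := by
    by_contra hc
    rcases (show t ≤ -2 ∨ 1 ≤ t by omega) with h | h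
    · have := mul_le_mul_of_nonneg_left h hN
      omega
    · have := mul_le_mul_of_nonneg_left h hN
      omega
  rcases htt with rfl | rfl
  · have hl : X (staircase (n - 3)).card = topSeq (n - 3) := funext fun i => by simpa using ht i
    obtain ⟨Y, hY⟩ := (hX.isIncreasingPath hl).exists_standardTableau hm
    refine ⟨(true, Y), fun j hj => ?_⟩
    have : orient true (Y.path j) = X j := hY j hj
    rw [this]
    exact hr j hj
  · have hl : reflect (X (staircase (n - 3)).card) = topSeq (n - 3) := by
      have : X (staircase (n - 3)).card = reflect (topSeq (n - 3)) :=
        funext fun i => (ht i).trans (reflect_topSeq i).symm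
      rw [this, reflect_reflect]
    obtain ⟨Y, hY⟩ := (hX.reflect.isIncreasingPath hl).exists_standardTableau hm
    refine ⟨(false, Y), fun j hj => ?_⟩
    have : orient false (Y.path j) = X j := by
      simp only [orient, hY j hj, reflect_reflect]
      rfl
    rw [this]
    exact hr j hj

theorem eq_of_represents (hn : 4 < n) {x y : Fin (n - 3) → ℤ} {A : CTFT n}
    (hx : IsArcSeq x) (hy : IsArcSeq y)
    (hA : Represents x A) (hA' : Represents y A) (h : ∑ i, x i = ∑ i, y i) : x = y := by
  obtain ⟨t, ht⟩ := hA.shift hn hx hy hA'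
  have h1 := sum_add_mul hn ht
  have h2 := two_le_card_staircase hn
  have h3 : ((staircase (n - 3)).card : ℤ) * t = 0 := by omega
  have h4 : t = 0 := (mul_eq_zero.1 h3).resolve_left (by omega)
  funext i
  rw [ht i, h4]
  simp

/-- Sums of lifts of the same triangulation differ by multiples of `2 N`, and `N ≥ 2`. This
separates the increasing from the decreasing geodesics after one step. -/
theorem sum_ne_of_represents (hn : 4 < n) {x y : Fin (n - 3) → ℤ} {A : CTFT n} (hx : IsArcSeq x)
    (hy : IsArcSeq y) (hA : Represents x A) (hA' : Represents y A) (h : ∑ i, x i = 1) :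
    ∑ i, y i ≠ -1 := by
  intro h'
  obtain ⟨t, ht⟩ := hA.shift hn hx hy hA'
  have h1 := sum_add_mul hn ht
  have h2 := two_le_card_staircase hn
  have h3 : ((staircase (n - 3)).card : ℤ) * -t = 1 := by rw [mul_neg]; omega
  have h4 := Int.le_of_dvd one_pos (Dvd.intro _ h3)
  omega

/-- The triangulation at time `1` determines the orientation. After that the sums agree at each
time, which fixes the lifts and with them the tableau. -/
theorem tableau_unique (hn : 4 < n) {A : ℕ → CTFT n}
    (q q' : Bool × StandardTableau (staircase (n - 3)))
    (h : ∀ j ≤ (staircase (n - 3)).card, Represents (orient q.1 (q.2.path j)) (A j))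
    (h' : ∀ j ≤ (staircase (n - 3)).card, Represents (orient q'.1 (q'.2.path j)) (A j)) :
    q = q' := by
  have hm : 2 ≤ n - 3 := by omega
  have h2 := two_le_card_staircase hn
  have hsum : ∀ (b : Bool) (Y : StandardTableau (staircase (n - 3))),
      ∀ j ≤ (staircase (n - 3)).card, ∑ i, orient b (Y.path j) i = if b then (j : ℤ) else -j := by
    intro b Y j hj
    rw [sum_orient, (Y.isIncreasingPath_path hm).sum j hj]
  obtain ⟨b, Y⟩ := q
  obtain ⟨b', Y'⟩ := q'
  have harc := fun j => (Y.path_isArcSeq hm j).orient b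
  have harc' := fun j => (Y'.path_isArcSeq hm j).orient b'
  have hb : b = b' := by
    have e := hsum b Y 1 (by omega)
    have e' := hsum b' Y' 1 (by omega)
    cases b <;> cases b'
    · rfl
    · exact absurd e (sum_ne_of_represents hn (harc' 1) (harc 1) (h' 1 (by omega))
        (h 1 (by omega)) e')
    · exact absurd e' (sum_ne_of_represents hn (harc 1) (harc' 1) (h 1 (by omega))
        (h' 1 (by omega)) e)
    · rfl
  subst hb
  congr 1
  refine Y.eq_of_path_eq hm Y' fun j hj => orient_injective b ?_
  exact eq_of_represents hn (harc j) (harc' j) (h j hj) (h' j hj)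
    ((hsum b Y j hj).trans (hsum b Y' j hj).symm)

/-- The geodesics are the tableaux and their reflections. -/
theorem exists_geodesic_equiv (hn : 4 < n) :
    ∃ e : Geodesic (star n hn) (starReverse n hn) ≃ Bool × StandardTableau (staircase (n - 3)),
      ∀ u, ∀ j ≤ (staircase (n - 3)).card,
        Represents (orient (e u).1 ((e u).2.path j)) (u.1.getVert j) := by
  choose f hf using exists_tableau_of_geodesic hn
  refine ⟨Equiv.ofBijective f ⟨fun u u' huu => ?_, fun q => ?_⟩, hf⟩
  · apply Subtype.ext
    refine SimpleGraph.Walk.ext_getVert_le_length (u.length.trans u'.length.symm) fun j hj => ?_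
    rw [u.length] at hj
    exact (hf u j hj).unique (huu ▸ hf u' j hj)
  · obtain ⟨u, hu⟩ := exists_geodesic_of_tableau hn q
    exact ⟨u, tableau_unique hn _ _ (hf u) hu⟩

theorem flipsDiagonal_of_represents (hn : 4 < n)
    (Y : StandardTableau (staircase (n - 3))) {A : ℕ → CTFT n}
    (h : ∀ j ≤ (staircase (n - 3)).card, Represents (Y.path j) (A j))
    (i : Finset.Icc 1 (staircase (n - 3)).card) :
    FlipsDiagonal (A (i.1 - 1)) (A i.1) s((Y.row i : ZMod n) - 1, (Y.col i : ZMod n) + 1) := by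
  have hm : 2 ≤ n - 3 := by omega
  obtain ⟨j, hj⟩ : ∃ j, i.1 = j + 1 := ⟨i.1 - 1, by have := Finset.mem_Icc.1 i.2; omega⟩
  have hjN := (Finset.mem_Icc.1 i.2).2
  obtain ⟨h1, h2⟩ := Y.path_succ hm j (Y.entry.symm i) (by rw [Equiv.apply_symm_apply, hj])
  have h3 := staircase_bounds (Y.entry.symm i)
  rw [hj, Nat.add_sub_cancel]
  refine ⟨_, ?_, (h j (by omega)).isFlip hn (Y.path_isArcSeq hm _) (Y.path_isArcSeq hm _)
    (h (j + 1) (by omega)) h1⟩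
  have h4 : ((Y.entry.symm i).1.1 : ℤ) - 1 + (diagonal (Y.entry.symm i)).val + 2 =
      (Y.entry.symm i).1.2 + 1 := by
    simp only [diagonal]
    omega
  rw [h j (by omega), arc, h2, h4, StandardTableau.row, StandardTableau.col]
  push_cast
  rfl

theorem flipsDiagonal_star_iff (hn : 4 < n) {B : CTFT n} (b : Bool)
    (Y : StandardTableau (staircase (n - 3)))
    (hB : Represents (orient b (Y.path 1)) B) :
    FlipsDiagonal (star n hn) B s(0, 2) ↔ b = true := by
  have hm : 2 ≤ n - 3 := by omega
  have hN := two_le_card_staircase hn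
  have hsum : ∑ i, Y.path 1 i = 1 := by
    simpa using (Y.isIncreasingPath_path hm).sum 1 (by omega)
  have h0 : IsArcSeq (0 : Fin (n - 3) → ℤ) := fun i j h => by simpa using h
  have hchord : (star n hn).chord ⟨0, by omega⟩ = s(0, 2) := by simp [star]
  constructor
  · rintro ⟨k, hk, hflip⟩
    obtain rfl : k = ⟨0, by omega⟩ := (star n hn).injective (hk.trans hchord.symm)
    obtain ⟨y, hy, hyB, hinc⟩ := (represents_star hn).of_isFlip hn h0 hflip
    have hy1 : ∑ i, y i = 1 := by
      rcases hinc with hinc | hinc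
      · simpa using hinc.sum
      -- Lowering the entry `0` of the zero sequence would leave it below the entry `1`.
      · exfalso
        have e0 := congrFun hinc ⟨0, by omega⟩
        have e1 := congrFun hinc ⟨1, by omega⟩
        rw [Function.update_self, Pi.zero_apply] at e0
        rw [Function.update_of_ne (by simp), Pi.zero_apply] at e1
        have := (hy ⟨0, by omega⟩ ⟨1, by omega⟩ (by simp)).1
        omega
    cases b
    · refine absurd ?_ (sum_ne_of_represents hn hy ((Y.path_isArcSeq hm 1).orient false) hyB hB hy1)
      rw [sum_orient, hsum]
      simp
    · rfl
  · rintro rfl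
    obtain ⟨k, hk⟩ := (Y.isIncreasingPath_path hm).step 0 (by omega)
    rw [Y.path_zero] at hk
    -- The entry `0` is the largest one, so it has to be raised first.
    have hk0 : k = ⟨0, by omega⟩ := by
      by_contra hne
      have e0 := congrFun hk ⟨0, by omega⟩
      have e1 := congrFun hk k
      rw [Function.update_of_ne (Ne.symm hne), Pi.zero_apply] at e0
      rw [Function.update_self, Pi.zero_apply] at e1
      have := (Y.path_isArcSeq hm 1 ⟨0, by omega⟩ k (Fin.mk_le_mk.2 (Nat.zero_le _))).1
      simp only [zero_add] at e0 e1
      omega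
    subst hk0
    exact ⟨_, hchord, (represents_star hn).isFlip hn h0 (Y.path_isArcSeq hm 1) hB hk⟩

end walks

end TFT

theorem mainTheorem3 (n : ℕ) (hn : 4 < n) :
    (∃ φ : TFT.GeodesicStarting (TFT.star n hn) (TFT.starReverse n hn) s(0, 2) ≃
          TFT.StandardTableau (TFT.shiftedDiagram (TFT.truncatedStaircase (n - 3))),
        ∀ u : TFT.GeodesicStarting (TFT.star n hn) (TFT.starReverse n hn) s(0, 2),
          u.1.1.length = (TFT.shiftedDiagram (TFT.truncatedStaircase (n - 3))).card ∧
          ∀ i : Finset.Icc 1 (TFT.shiftedDiagram (TFT.truncatedStaircase (n - 3))).card,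
            TFT.FlipsDiagonal (u.1.1.getVert (i.1 - 1)) (u.1.1.getVert i.1)
              s(((φ u).row i : ZMod n) - 1, ((φ u).col i : ZMod n) + 1)) ∧
    Nat.card (TFT.Geodesic (TFT.star n hn) (TFT.starReverse n hn)) =
      2 * Nat.card (TFT.StandardTableau
        (TFT.shiftedDiagram (TFT.truncatedStaircase (n - 3)))) := by
  obtain ⟨e, he⟩ := TFT.exists_geodesic_equiv hn
  have hN := TFT.two_le_card_staircase hn
  have hstart : ∀ u : TFT.Geodesic (TFT.star n hn) (TFT.starReverse n hn),
      TFT.FlipsDiagonal (u.1.getVert 0) (u.1.getVert 1) s(0, 2) ↔ (e u).1 = true := by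
    intro u
    rw [SimpleGraph.Walk.getVert_zero]
    exact TFT.flipsDiagonal_star_iff hn _ (e u).2 (he u 1 (by omega))
  refine ⟨⟨⟨fun u => (e u.1).2, fun Y => ⟨e.symm (true, Y), (hstart _).2 (by simp)⟩,
    fun u => Subtype.ext ?_, fun Y => by simp⟩, fun u => ⟨u.1.length hn, fun i => ?_⟩⟩, ?_⟩
  · rw [Equiv.symm_apply_eq]
    exact Prod.ext ((hstart u.1).1 u.2).symm rfl
  · refine TFT.flipsDiagonal_of_represents hn (e u.1).2 (A := u.1.1.getVert) (fun j hj => ?_) i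
    have h := he u.1 j hj
    rwa [(hstart u.1).1 u.2] at h
  · rw [Nat.card_congr e, Nat.card_prod, Nat.card_eq_fintype_card (α := Bool), Fintype.card_bool]
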